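/- Let $\mathbb{C}\langle\varepsilon\rangle$ be the field of Puiseux series $\sum_{i\ge i_0}a_i\varepsilon^{i/q}$ ($i_0\in\mathbb{Z}$, $q\in\mathbb{Z}_{>0}$, $a_i\in\mathbb{C}$); such a series is bounded if it has no negative exponents, and its limit $\lim_{\varepsilon\to0}$ is then its constant term. For $V\subset\mathbb{C}\langle\varepsilon\rangle^n$ let $\lim_{\varepsilon\to0}V\subset\mathbb{C}^n$ be the set of limits of those points of $V$ all of whose coordinates are bounded. For sets $V_t\subset\mathbb{C}^n$, $t\in(0,1]$, $\lim_{t\to0}V_t=L$ means that $V_t$ converges to $L$ in the sense of Painlev\'e and Kuratowski as $t\to0^+$: for $x\in L$ every neighbourhood of $x$ meets $V_t$ for all sufficiently small $t>0$, and every $x\in\mathbb{C}^n$ each of whose neighbourhoods meets $V_t$ for arbitrarily small $t>0$ lies in $L$. An algebraic set is equidimensional of dimension $d$ if all its irreducible components have dimension $d$ (the empty set is allowed), and it is smooth if each of its points $z$ lies on exactly one irreducible component $Z$ and $\dim T_z(Z)=\dim Z$. Let $f,g_1,\dots,g_m\in\mathbb{R}[x_1,\dots,x_n]$. Assume that $\mathcal{V}_\varepsilon:=V(f-\varepsilon,g_1,\dots,g_m)\subset\mathbb{C}\langle\varepsilon\rangle^n$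 is smooth and equidimensional of dimension $n-m-1$. Let $\xi\in\mathbb{C}$ with $|\xi|=1$ be such that $\mathcal{V}_{t\xi}:=V(f-t\xi,g_1,\dots,g_m)\subset\mathbb{C}^n$ is smooth and equidimensional of dimension $n-m-1$ for all $t\in(0,1]$. Then $\lim_{t\to0}\mathcal{V}_{t\xi}$ exists and $$\lim_{\varepsilon\to0}\mathcal{V}_\varepsilon=\lim_{t\to0}\mathcal{V}_{t\xi}.$$ -/

import Mathlib

/-! ### Puiseux series -/

/-- The substitution `∑ a_i T ^ i ↦ ∑ a_i ε ^ (i / q)`, as a map from Laurent series to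
Hahn series with rational exponents. -/
noncomputable def puiseuxRamify (K : Type*) [Field K] (q : ℕ) (hq : 0 < q) :
    HahnSeries ℤ K →+* HahnSeries ℚ K :=
  HahnSeries.embDomainRingHom
    { toFun := fun i => (i : ℚ) / q, map_zero' := by simp,
      map_add' := fun a b => by push_cast; ring }
    (fun a b h => by
      have hq' : (q : ℚ) ≠ 0 := by positivity
      have h' : (a : ℚ) / q = (b : ℚ) / q := h
      field_simp at h'
      exact_mod_cast h')
    (fun a b => by
      have hq' : (0 : ℚ) < q := by exact_mod_cast hq
      change (a : ℚ) / q ≤ (b : ℚ) / q ↔ a ≤ b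
      rw [div_le_div_iff_of_pos_right hq']
      exact Int.cast_le)

theorem mem_puiseuxRamify_iff {K : Type*} [Field K] (q : ℕ) (hq : 0 < q) (x : HahnSeries ℚ K) :
    x ∈ (puiseuxRamify K q hq).fieldRange ↔
      ∀ r : ℚ, x.coeff r ≠ 0 → ∃ i : ℤ, r = (i : ℚ) / q := by
  constructor
  · rintro ⟨y, rfl⟩ r hr
    by_contra hne
    refine hr (HahnSeries.embDomain_of_notMem_range ?_)
    rintro ⟨i, hi⟩
    exact hne ⟨i, hi.symm⟩
  · intro h
    have hq' : (0 : ℚ) < q := by exact_mod_cast hq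
    have hmono : StrictMono (fun i : ℤ => (i : ℚ) / q) := fun a b hab => by
      have : (a : ℚ) < b := by exact_mod_cast hab
      exact div_lt_div_of_pos_right this hq'
    have hpwo : (Function.support fun i : ℤ => x.coeff ((i : ℚ) / q)).IsPWO := by
      have hx := x.isWF_support
      refine Set.IsWF.isPWO ?_
      rw [Set.isWF_iff_no_descending_seq] at hx ⊢
      intro s hs hmem
      exact hx (fun k => (s k : ℚ) / q) (fun a b hab => hmono (hs hab)) (fun k => hmem k)
    refine ⟨⟨fun i : ℤ => x.coeff ((i : ℚ) / q), hpwo⟩, ?_⟩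
    ext r
    by_cases hr : ∃ i : ℤ, r = (i : ℚ) / q
    · obtain ⟨i, rfl⟩ := hr
      exact HahnSeries.embDomain_coeff (a := i)
    · have h0 : x.coeff r = 0 := by
        by_contra hne
        exact hr (h r hne)
      rw [h0]
      refine HahnSeries.embDomain_of_notMem_range ?_
      rintro ⟨i, hi⟩
      exact hr ⟨i, hi.symm⟩

/-- A Hahn series with rational exponents is a Puiseux series if its exponents have a common
denominator `q > 0`. (The support of a Hahn series is well-ordered, so the exponents are then
automatically bounded below: the series is `∑_{i ≥ i₀} a_i ε ^ (i / q)`.) -/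
def IsPuiseux {K : Type*} [Field K] (x : HahnSeries ℚ K) : Prop :=
  ∃ q : ℕ, 0 < q ∧ ∀ r : ℚ, x.coeff r ≠ 0 → ∃ i : ℤ, r = (i : ℚ) / q

theorem IsPuiseux.of_mem {K : Type*} [Field K] {q : ℕ} {hq : 0 < q} {x : HahnSeries ℚ K}
    (h : x ∈ (puiseuxRamify K q hq).fieldRange) : IsPuiseux x :=
  ⟨q, hq, (mem_puiseuxRamify_iff q hq x).1 h⟩

theorem IsPuiseux.common {K : Type*} [Field K] {x y : HahnSeries ℚ K}
    (hx : IsPuiseux x) (hy : IsPuiseux y) :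
    ∃ (q : ℕ) (hq : 0 < q), x ∈ (puiseuxRamify K q hq).fieldRange ∧
      y ∈ (puiseuxRamify K q hq).fieldRange := by
  have key : ∀ (z : HahnSeries ℚ K) (p q : ℕ) (_ : 0 < p) (_ : 0 < q),
      (∀ r : ℚ, z.coeff r ≠ 0 → ∃ i : ℤ, r = (i : ℚ) / p) →
      ∀ r : ℚ, z.coeff r ≠ 0 → ∃ i : ℤ, r = (i : ℚ) / (p * q : ℕ) := by
    intro z p q hp hq h r hr
    obtain ⟨i, rfl⟩ := h r hr
    refine ⟨i * q, ?_⟩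
    have hp' : (p : ℚ) ≠ 0 := by positivity
    have hq' : (q : ℚ) ≠ 0 := by positivity
    push_cast
    field_simp
  obtain ⟨p, hp, hx⟩ := hx
  obtain ⟨q, hq, hy⟩ := hy
  have hy' := key y q p hq hp hy
  rw [Nat.mul_comm q p] at hy'
  exact ⟨p * q, Nat.mul_pos hp hq, (mem_puiseuxRamify_iff _ _ x).2 (key x p q hp hq hx),
    (mem_puiseuxRamify_iff _ _ y).2 hy'⟩

theorem isPuiseux_C {K : Type*} [Field K] (a : K) :
    IsPuiseux (HahnSeries.C a : HahnSeries ℚ K) :=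
  IsPuiseux.of_mem (q := 1) (hq := one_pos) ⟨HahnSeries.C a, HahnSeries.embDomainRingHom_C⟩

/-- The field `K⟨ε⟩` of Puiseux series over `K`, as a subfield of the Hahn series with
rational exponents. -/
noncomputable def puiseuxSubfield (K : Type*) [Field K] : Subfield (HahnSeries ℚ K) where
  carrier := {x | IsPuiseux x}
  zero_mem' := by simpa using isPuiseux_C (0 : K)
  one_mem' := by simpa using isPuiseux_C (1 : K)
  add_mem' {x y} hx hy := by
    obtain ⟨q, hq, h1, h2⟩ := IsPuiseux.common hx hy
    exact IsPuiseux.of_mem (add_mem h1 h2)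
  mul_mem' {x y} hx hy := by
    obtain ⟨q, hq, h1, h2⟩ := IsPuiseux.common hx hy
    exact IsPuiseux.of_mem (mul_mem h1 h2)
  neg_mem' {x} hx := by
    obtain ⟨q, hq, h1, -⟩ := IsPuiseux.common hx hx
    exact IsPuiseux.of_mem (neg_mem h1)
  inv_mem' x hx := by
    obtain ⟨q, hq, h1, -⟩ := IsPuiseux.common hx hx
    exact IsPuiseux.of_mem (inv_mem h1)

/-- The field `K⟨ε⟩` of Puiseux series over `K`. -/
abbrev Puiseux (K : Type*) [Field K] : Type _ := puiseuxSubfield K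

namespace Puiseux

/-- Constant Puiseux series. -/
noncomputable def const (K : Type*) [Field K] : K →+* Puiseux K :=
  (HahnSeries.C : K →+* HahnSeries ℚ K).codRestrict (puiseuxSubfield K) isPuiseux_C

/-- The infinitesimal `ε`. -/
noncomputable def eps (K : Type*) [Field K] : Puiseux K :=
  ⟨HahnSeries.single (1 : ℚ) (1 : K), 1, one_pos, fun r hr => ⟨1, by
    by_contra hne
    exact hr (HahnSeries.coeff_single_of_ne (by simpa using hne))⟩⟩

/-- The coefficient of `ε ^ r`. -/
def coeff {K : Type*} [Field K] (x : Puiseux K) (r : ℚ) : K := (x : HahnSeries ℚ K).coeff r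

/-- A Puiseux series is bounded if it has no negative exponents. -/
def IsBounded {K : Type*} [Field K] (x : Puiseux K) : Prop := ∀ r : ℚ, r < 0 → x.coeff r = 0

/-- `lim_{ε → 0} V ⊆ Kⁿ` for `V ⊆ K⟨ε⟩ⁿ`: the constant terms of the points of `V` all of whose
coordinates are bounded. -/
def limitSet {K : Type*} [Field K] {n : ℕ} (V : Set (Fin n → Puiseux K)) : Set (Fin n → K) :=
  {a | ∃ x ∈ V, ∀ i, (x i).IsBounded ∧ (x i).coeff 0 = a i}

end Puiseux

/-! ### Algebraic sets in `Kⁿ` -/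

section AlgebraicSets

variable {K : Type*} [Field K] {n : ℕ}

/-- Algebraic subsets of `Kⁿ`. -/
def IsAlgebraicSet (Z : Set (Fin n → K)) : Prop :=
  ∃ F : Set (MvPolynomial (Fin n) K), Z = {x | ∀ p ∈ F, MvPolynomial.eval x p = 0}

/-- A nonempty algebraic set that is not the union of two proper algebraic subsets. -/
def IsIrreducibleAlgebraicSet (Z : Set (Fin n → K)) : Prop :=
  IsAlgebraicSet Z ∧ Z.Nonempty ∧
    ∀ A B : Set (Fin n → K), IsAlgebraicSet A → IsAlgebraicSet B → Z = A ∪ B → Z = A ∨ Z = B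

/-- The irreducible components of `V`: the maximal irreducible algebraic subsets. -/
def IsIrreducibleComponent (V Z : Set (Fin n → K)) : Prop :=
  Maximal (fun Y => IsIrreducibleAlgebraicSet Y ∧ Y ⊆ V) Z

/-- The dimension of an algebraic set: the Krull dimension of its coordinate ring. -/
noncomputable def algDim (Z : Set (Fin n → K)) : WithBot ℕ∞ :=
  ringKrullDim (MvPolynomial (Fin n) K ⧸ MvPolynomial.vanishingIdeal K Z)

/-- The Zariski tangent space `T_z(Z) ⊆ Kⁿ`, cut out by the differentials at `z` of all the
polynomials vanishing on `Z`. -/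
def tangentSpaceAt (Z : Set (Fin n → K)) (z : Fin n → K) : Submodule K (Fin n → K) where
  carrier := {v | ∀ p ∈ MvPolynomial.vanishingIdeal K Z,
    ∑ i, MvPolynomial.eval z (MvPolynomial.pderiv i p) * v i = 0}
  zero_mem' := fun p _ => by simp
  add_mem' := fun {v w} hv hw p hp => by
    simp only [Pi.add_apply, mul_add, Finset.sum_add_distrib, hv p hp, hw p hp, add_zero]
  smul_mem' := fun c v hv p hp => by
    have h := hv p hp
    simp only [Pi.smul_apply, smul_eq_mul, mul_left_comm _ c, ← Finset.mul_sum, h, mul_zero]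

/-- `z` is a smooth point of `V`: it lies on exactly one irreducible component `Z` of `V`, and
`dim T_z(Z) = dim Z`. -/
def IsSmoothPoint (V : Set (Fin n → K)) (z : Fin n → K) : Prop :=
  ∃ Z, (IsIrreducibleComponent V Z ∧ z ∈ Z) ∧
    (∀ Y, IsIrreducibleComponent V Y → z ∈ Y → Y = Z) ∧
    (Module.finrank K (tangentSpaceAt Z z) : WithBot ℕ∞) = algDim Z

/-- All points of `V` are smooth. -/
def IsSmoothAlgebraicSet (V : Set (Fin n → K)) : Prop := ∀ z ∈ V, IsSmoothPoint V z

/-- All irreducible components of `V` have dimension `d`. The integer `d` may be negative; then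
`V` has no irreducible components. -/
def IsEquidimensional (V : Set (Fin n → K)) (d : ℤ) : Prop :=
  ∀ Z, IsIrreducibleComponent V Z → ∃ k : ℕ, algDim Z = (k : WithBot ℕ∞) ∧ (k : ℤ) = d

/-- `V(f - c, g_1, …, g_m) ⊆ Kⁿ` for real polynomials `f, g_1, …, g_m`, a field `K` containing
`ℝ` through `φ`, and `c ∈ K`. -/
def fiberSet (φ : ℝ →+* K) {m : ℕ} (f : MvPolynomial (Fin n) ℝ)
    (g : Fin m → MvPolynomial (Fin n) ℝ) (c : K) : Set (Fin n → K) :=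
  {x | MvPolynomial.eval₂ φ x f - c = 0 ∧ ∀ j, MvPolynomial.eval₂ φ x (g j) = 0}

end AlgebraicSets

/-! ### Limits of families of sets -/

/-- The family `V` of sets converges to the set `L` along the filter `l` (in the sense of
Painlevé and Kuratowski): every point of `L` is approached by `V t` for all `t` near the limit,
and every point that is approached by `V t` for arbitrarily late `t` is in `L`.
The limit `L` is unique when `l` is not trivial. -/
def HasSetLimit {T X : Type*} [TopologicalSpace X] (V : T → Set X) (l : Filter T)
    (L : Set X) : Prop :=
  (∀ x ∈ L, ∀ U ∈ nhds x, ∀ᶠ t in l, (V t ∩ U).Nonempty) ∧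
    ∀ x, (∀ U ∈ nhds x, ∃ᶠ t in l, (V t ∩ U).Nonempty) → x ∈ L

/-!
Both limits are the same explicit set, which depends neither on `ξ` nor on the field: the points
`a` with `f a = 0` that lie in the Zariski closure of `V(g) \ V(f)`. This is `IsLimitPoint`; its
second half says that `p a = 0` whenever `f ^ N * p` lies in the ideal generated by the `g j`.

Points of the two limits satisfy this condition for a simple reason. A point `x` of a fibre has
`f x ≠ 0` and `g j x = 0`, so that `f ^ N * p ∈ (g)` forces `p x = 0`, and both `p x = 0` and the
smallness of `f x` pass to the limit (`IsLimitPoint.of_specializing`,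
`isLimitPoint_of_frequently`).

The converse is a statement about a valuation ring `O` of an algebraically closed field `L`: for
every nonzero `τ` in the maximal ideal of `O`, a limit point `a` is the specialization of an
`L`-valued point of the fibre over `τ` (`IsLimitPoint.exists_specializing`, from
`exists_algHom_specializing`). By Noether normalization, restriction to a line and going-down, there
is a curve through `a` in `V(g)` on which `f` does not vanish identically
(`exists_prime_trdeg_quotient_le_one`). Its function field is finite over `k(f)`, and some valuation
ring of it is centred at `a`. Its trace on `k(f)` is the valuation ring of the point `f = 0`, the
only one containing `k` whose maximal ideal contains `f`; the embedding `f ↦ τ` of `k(f)` into `L`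
induces the same one. Valuation rings of a finite Galois extension with a common restriction are
conjugate (`exists_conjugate_valuationSubring`), so that the embedding extends to the function field
compatibly with the valuation ring centred at `a` (`exists_extension_of_place`).

This applies to two valued fields. For the Puiseux series and `τ = ε` it describes the limit of the
fibre over `ε`. The field of Puiseux series is algebraically closed by the Newton–Puiseux theorem,
which is proved here from the Weierstrass preparation theorem. For the germs of functions along an
ultrafilter that refines `t → 0⁺`, and the germ `τ = tξ`, it shows that no such ultrafilter can
avoid a neighbourhood of `a`; hence the fibres over `tξ` meet each neighbourhood of `a` for all
sufficiently small `t`.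
-/

/-! ### Conjugacy of valuation rings in a finite Galois extension -/

/-- An element lying in every valuation ring that contains the image of `R` is integral
over `R`. -/
theorem isIntegral_of_forall_mem_valuationSubring {R E : Type*} [CommRing R] [Field E]
    [Algebra R E] {z : E}
    (h : ∀ W : ValuationSubring E, (∀ r : R, algebraMap R E r ∈ W) → z ∈ W) :
    IsIntegral R z := by
  have hz : z ∈ (integralClosure (Subring.closure (Set.range (algebraMap R E))) E).toSubring := by
    rw [← iInf_valuationSubring_superset, Subring.mem_iInf]
    exact fun W => h W.1 fun r => W.2 ⟨r, rfl⟩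
  have hz' : IsIntegral (Subring.closure (Set.range (algebraMap R E))) z := hz
  have hcl : Subring.closure (Set.range (algebraMap R E)) = (algebraMap R E).range := by
    rw [← RingHom.coe_range, Subring.closure_eq]
  rw [hcl] at hz'
  let _ : Algebra R (algebraMap R E).range := (algebraMap R E).rangeRestrict.toAlgebra
  have : IsScalarTower R (algebraMap R E).range E := IsScalarTower.of_algebraMap_eq fun _ => rfl
  have : Algebra.IsIntegral R (algebraMap R E).range :=
    ⟨RingHom.isIntegral_of_surjective _ (algebraMap R E).rangeRestrict_surjective⟩
  exact isIntegral_trans (R := R) z hz'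

theorem mem_nonunits_comap_iff {F E : Type*} [Field F] [Field E] (V : ValuationSubring E)
    (φ : F →+* E) {x : F} : x ∈ (V.comap φ).nonunits ↔ φ x ∈ V.nonunits := by
  simp [ValuationSubring.mem_nonunits_iff_or]

/-- Over an algebraic extension, an element `x` of a valuation ring `V` is a quotient `b / c` of
elements that are integral over the restriction of `V` to the base field, with `c` a unit
of `V`. Hence `V` is a localization of the integral closure of its restriction. -/
theorem exists_isIntegral_mul_eq_of_mem_valuationSubring {F E : Type*} [Field F] [Field E]
    [Algebra F E] [Algebra.IsAlgebraic F E] (V : ValuationSubring E) {x : E} (hx : x ∈ V) :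
    ∃ b c : E, IsIntegral (V.comap (algebraMap F E)) b ∧
      IsIntegral (V.comap (algebraMap F E)) c ∧ c ∉ V.nonunits ∧ x * c = b := by
  rcases eq_or_ne x 0 with rfl | hx0
  · exact ⟨0, 1, isIntegral_zero, isIntegral_one, by simp [V.mem_nonunits_iff], by simp⟩
  obtain ⟨p, hp0, hpx⟩ := Algebra.IsAlgebraic.isAlgebraic (R := F) x
  set v := (V.comap (algebraMap F E)).valuation with hv
  -- the last index at which the coefficients of `p` attain their largest valuation
  obtain ⟨i₀, hi₀, hmax⟩ := p.support.exists_max_image (fun i => toLex (v (p.coeff i), i))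
    (Polynomial.support_nonempty.2 hp0)
  have hpi : p.coeff i₀ ≠ 0 := Polynomial.mem_support_iff.1 hi₀
  have hvi : v (p.coeff i₀) ≠ 0 := (v.ne_zero_iff).2 hpi
  set a : ℕ → F := fun i => p.coeff i / p.coeff i₀ with ha
  have hai : a i₀ = 1 := div_self hpi
  have hle : ∀ i, v (a i) ≤ 1 ∧ (i₀ < i → v (a i) < 1) := by
    intro i
    rcases eq_or_ne (p.coeff i) 0 with h0 | h0
    · simp [ha, h0]
    have := hmax i (Polynomial.mem_support_iff.2 h0)
    rw [Prod.Lex.toLex_le_toLex] at this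
    have e : v (a i) = v (p.coeff i) / v (p.coeff i₀) := map_div₀ _ _ _
    rw [e, div_le_one₀ (zero_lt_iff.2 hvi), div_lt_one₀ (zero_lt_iff.2 hvi)]
    rcases this with h | ⟨h1, h2⟩
    · exact ⟨h.le, fun _ => h⟩
    · exact ⟨h1.le, fun h => absurd h2 (not_le.2 h)⟩
  have haV : ∀ i, algebraMap F E (a i) ∈ V := fun i => by
    have := (hle i).1
    rwa [hv, ValuationSubring.valuation_le_one_iff] at this
  have haN : ∀ i, i₀ < i → algebraMap F E (a i) ∈ V.nonunits := fun i hi => by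
    rw [← mem_nonunits_comap_iff, ValuationSubring.mem_nonunits_iff]
    exact (hle i).2 hi
  -- `c` is the quotient of the relation by `x ^ i₀`, without its terms of negative exponent
  obtain ⟨M, hM⟩ : ∃ M, p.natDegree + 1 = i₀ + (M + 1) :=
    ⟨p.natDegree - i₀, by have := Polynomial.le_natDegree_of_mem_supp _ hi₀; omega⟩
  set c : E := ∑ j ∈ Finset.range (M + 1), algebraMap F E (a (i₀ + j)) * x ^ j with hc
  have hrel : ∑ i ∈ Finset.range i₀, algebraMap F E (a i) * x ^ i + x ^ i₀ * c = 0 := by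
    have h1 : ∑ i ∈ Finset.range (p.natDegree + 1), algebraMap F E (p.coeff i) * x ^ i = 0 := by
      rw [Polynomial.aeval_eq_sum_range] at hpx
      simpa [Algebra.smul_def] using hpx
    have h2 : ∑ i ∈ Finset.range (i₀ + (M + 1)), algebraMap F E (a i) * x ^ i = 0 := by
      rw [← hM]
      calc _ = (∑ i ∈ Finset.range (p.natDegree + 1), algebraMap F E (p.coeff i) * x ^ i) *
            (algebraMap F E (p.coeff i₀))⁻¹ := by
            rw [Finset.sum_mul]
            refine Finset.sum_congr rfl fun i _ => ?_
            simp only [ha, map_div₀]; ring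
        _ = 0 := by rw [h1, zero_mul]
    rw [Finset.sum_range_add] at h2
    rw [← h2, hc, Finset.mul_sum]
    congr 1
    refine Finset.sum_congr rfl fun j _ => ?_
    rw [pow_add]; ring
  have hcinv : c = -∑ i ∈ Finset.range i₀, algebraMap F E (a i) * x⁻¹ ^ (i₀ - i) := by
    have : x ^ i₀ * c = -∑ i ∈ Finset.range i₀, algebraMap F E (a i) * x ^ i := by
      linear_combination hrel
    rw [← mul_right_inj' (pow_ne_zero i₀ hx0), this, mul_neg, Finset.mul_sum]
    congr 1
    refine Finset.sum_congr rfl fun i hi => ?_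
    have hi' : i₀ = i + (i₀ - i) := by have := Finset.mem_range.1 hi; omega
    rw [inv_pow]
    nth_rw 1 [hi']
    rw [pow_add]
    field_simp
  have hbinv : x * c = -∑ i ∈ Finset.range i₀, algebraMap F E (a i) * x⁻¹ ^ (i₀ - i - 1) := by
    rw [hcinv, mul_neg, Finset.mul_sum]
    congr 1
    refine Finset.sum_congr rfl fun i hi => ?_
    have hi' : i₀ - i = (i₀ - i - 1) + 1 := by have := Finset.mem_range.1 hi; omega
    nth_rw 1 [hi']
    rw [pow_succ]
    field_simp
  have haW : ∀ W : ValuationSubring E,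
      (∀ r : V.comap (algebraMap F E), algebraMap (V.comap (algebraMap F E)) E r ∈ W) →
      ∀ i, algebraMap F E (a i) ∈ W := fun W hW i => hW ⟨a i, haV i⟩
  have hcW : ∀ W : ValuationSubring E, (∀ i, algebraMap F E (a i) ∈ W) → x ∈ W → c ∈ W :=
    fun W hW hxW => sum_mem fun j _ => mul_mem (hW _) (pow_mem hxW _)
  -- a valuation ring contains `x`, and then the first formula for `c` shows that it contains `c`
  -- and `x * c`, or it contains `x⁻¹`, and then the second one does
  refine ⟨x * c, c, isIntegral_of_forall_mem_valuationSubring fun W hW => ?_,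
    isIntegral_of_forall_mem_valuationSubring fun W hW => ?_, ?_, rfl⟩
  · rcases W.mem_or_inv_mem x with h | h
    · exact mul_mem h (hcW W (haW W hW) h)
    · rw [hbinv]
      exact neg_mem (sum_mem fun j _ => mul_mem (haW W hW _) (pow_mem h _))
  · rcases W.mem_or_inv_mem x with h | h
    · exact hcW W (haW W hW) h
    · rw [hcinv]
      exact neg_mem (sum_mem fun j _ => mul_mem (haW W hW _) (pow_mem h _))
  · intro hcN
    rw [hc, Finset.sum_range_succ'] at hcN
    simp only [add_zero, hai, map_one, pow_zero, mul_one] at hcN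
    have h1 : ∑ j ∈ Finset.range M, algebraMap F E (a (i₀ + (j + 1))) * x ^ (j + 1) ∈
        V.nonunits := by
      refine sum_mem fun j _ => ?_
      have h2 := haN (i₀ + (j + 1)) (by omega)
      rw [V.mem_nonunits_iff] at h2 ⊢
      rw [map_mul]
      exact mul_lt_one_of_nonneg_of_lt_one_left zero_le h2
        ((V.valuation_le_one_iff _).2 (pow_mem hx _))
    have := sub_mem hcN h1
    rw [add_sub_cancel_left, V.mem_nonunits_iff] at this
    simp at this

/-- Two valuation rings of a finite Galois extension with the same restriction to the base field
are conjugate; only the inclusion between the maximal ideals is recorded. Both rings are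
localizations of the integral closure of the restriction, at primes with the same trace, and the
Galois group acts transitively on those. -/
theorem exists_conjugate_valuationSubring {F E : Type*} [Field F] [Field E]
    [Algebra F E] [FiniteDimensional F E] [IsGalois F E] (V W : ValuationSubring E)
    (hVW : V.comap (algebraMap F E) = W.comap (algebraMap F E)) :
    ∃ σ : E →+* E, (∀ y : F, σ (algebraMap F E y) = algebraMap F E y) ∧
      ∀ x ∈ V.nonunits, σ x ∈ W.nonunits := by
  set R := V.comap (algebraMap F E) with hR
  have hint : ∀ (U : ValuationSubring E), U.comap (algebraMap F E) = R → ∀ z : E,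
      IsIntegral R z → z ∈ U := by
    rintro U hU z ⟨p, hp, hpz⟩
    have h2 : IsIntegral U z := by
      let f : R →+* U := (algebraMap F E).restrict R.toSubring U.toSubring
        (fun y hy => by rw [← hU] at hy; exact hy)
      refine ⟨p.map f, hp.map _, ?_⟩
      rw [Polynomial.eval₂_map]; exact hpz
    obtain ⟨y, rfl⟩ := IsIntegrallyClosed.isIntegral_iff.1 h2
    exact y.2
  let B := integralClosure R E
  -- the trace of the maximal ideal of `U` on the integral closure
  let ideal (U : ValuationSubring E) (hU : U.comap (algebraMap F E) = R) : Ideal B :=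
    { carrier := {b | (b : E) ∈ U.nonunits}
      add_mem' := fun ha hb => U.nonunits.add_mem ha hb
      zero_mem' := U.nonunits.zero_mem
      smul_mem' := fun c x hx => by
        change (c * x : E) ∈ U.nonunits
        have hx' : (x : E) ∈ U.nonunits := hx
        rw [U.mem_nonunits_iff] at hx' ⊢
        rw [map_mul]
        exact mul_lt_one_of_nonneg_of_lt_one_right ((U.valuation_le_one_iff _).2 (hint U hU _ c.2))
          zero_le hx' }
  have hprime : ∀ U hU, (ideal U hU).IsPrime := fun U hU => by
    refine ⟨fun h => ?_, fun {x y} hxy => ?_⟩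
    · have : (1 : E) ∈ U.nonunits := (Ideal.eq_top_iff_one _).1 h
      simp [U.mem_nonunits_iff] at this
    · by_contra! hcon
      have h1 : ¬ U.valuation (x : E) < 1 := fun h => hcon.1 ((U.mem_nonunits_iff).2 h)
      have h2 : ¬ U.valuation (y : E) < 1 := fun h => hcon.2 ((U.mem_nonunits_iff).2 h)
      have h3 : U.valuation (x * y : E) < 1 := (U.mem_nonunits_iff).1 hxy
      rw [map_mul] at h3
      exact absurd h3 (not_lt.2 (one_le_mul (not_lt.1 h1) (not_lt.1 h2)))
  have hunder : ∀ U hU (r : R), algebraMap R B r ∈ ideal U hU ↔ (r : F) ∈ R.nonunits := by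
    rintro U hU ⟨r, hr⟩
    change algebraMap F E r ∈ U.nonunits ↔ r ∈ R.nonunits
    rw [← hU, mem_nonunits_comap_iff]
  have := hprime V rfl
  have := hprime W hVW.symm
  have : IsFractionRing B E := integralClosure.isFractionRing_of_finite_extension F E
  have hinv : Algebra.IsInvariant R B (B ≃ₐ[R] B) := Algebra.isInvariant_of_isGalois' R F E B
  have hfin : Finite (B ≃ₐ[R] B) := Finite.of_equiv _ (galRestrict R F E B).toEquiv
  obtain ⟨g, hg⟩ := Algebra.IsInvariant.exists_smul_of_under_eq R B (B ≃ₐ[R] B)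
    (ideal V rfl) (ideal W hVW.symm) (by
      ext r
      exact (hunder V rfl r).trans (hunder W hVW.symm r).symm)
  let σ := (galRestrict R F E B).symm g
  have hσ : ∀ b : B, σ (b : E) = (g b : E) := fun b => by
    have := algebraMap_galRestrict_apply R σ b
    rw [MulEquiv.apply_symm_apply] at this
    exact this.symm
  have hmem : ∀ b : B, g b ∈ ideal W hVW.symm ↔ b ∈ ideal V rfl := fun b => by
    rw [hg]
    exact Ideal.smul_mem_pointwise_smul_iff (a := g)
  refine ⟨σ, fun y => σ.commutes y, fun x hx => ?_⟩
  obtain ⟨b, c, hb, hc, hcV, hbc⟩ := exists_isIntegral_mul_eq_of_mem_valuationSubring (F := F) V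
    (V.mem_nonunits_iff_exists_mem_maximalIdeal.1 hx).1
  have hbV : b ∈ V.nonunits := by
    rw [← hbc]
    rw [V.mem_nonunits_iff] at hx ⊢
    rw [map_mul]
    exact mul_lt_one_of_nonneg_of_lt_one_left zero_le hx
      ((V.valuation_le_one_iff _).2 (hint V rfl _ hc))
  have h1 : σ b ∈ W.nonunits := by
    have := (hmem ⟨b, hb⟩).2 hbV
    rw [show σ b = g ⟨b, hb⟩ from hσ ⟨b, hb⟩]
    exact this
  have h2 : σ c ∉ W.nonunits := by
    rw [show σ c = g ⟨c, hc⟩ from hσ ⟨c, hc⟩]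
    exact fun h => hcV ((hmem ⟨c, hc⟩).1 h)
  change σ x ∈ W.nonunits
  rw [← hbc, map_mul, W.mem_nonunits_iff, map_mul] at h1
  rw [W.mem_nonunits_iff, not_lt] at h2
  rw [W.mem_nonunits_iff]
  by_contra hcon
  exact absurd h1 (not_lt.2 (one_le_mul (not_lt.1 hcon) h2))

/-! ### Extension of places -/

/-- A proper ideal of a subring of a field is the trace of the maximal ideal of some valuation
ring, up to inclusion. -/
theorem exists_valuationSubring_of_injective {D K : Type*} [CommRing D] [Field K] (j : D →+* K)
    (hj : Function.Injective j) (I : Ideal D) (hI : I ≠ ⊤) :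
    ∃ V : ValuationSubring K, (∀ d, j d ∈ V) ∧ ∀ d ∈ I, j d ∈ V.nonunits := by
  let e : D ≃+* j.range := RingEquiv.ofBijective j.rangeRestrict
    ⟨fun x y h => hj (congrArg Subtype.val h), j.rangeRestrict_surjective⟩
  have hI' : I.comap (e.symm : j.range →+* D) ≠ ⊤ := by
    intro h
    apply hI
    rw [Ideal.eq_top_iff_one] at h ⊢
    simpa using h
  obtain ⟨V, hV, hVI⟩ := Ideal.image_subset_nonunits_valuationSubring _ hI'
  refine ⟨V, fun d => hV ⟨d, rfl⟩, fun d hd => hVI ⟨e d, ?_, rfl⟩⟩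
  change e.symm (e d) ∈ I
  simpa using hd

/-- **Extension of places.** Let `K` be a finite extension of `F`, `D ⊆ K` a ring, `I` a proper
ideal of `D`. If all the valuation rings of `F` that are compatible with `(D, I)` agree with the
one induced by `ψ : F → L`, where `L` is algebraically closed, then `ψ` extends to `K` in such a
way that `I` goes into the maximal ideal of `O`.

In the normal closure `E` of `K`, one valuation ring comes from `(D, I)` and another one from `O`
through an arbitrary extension of `ψ`. They have the same restriction to `F`, so an automorphism
of `E` over `F` corrects the extension. -/
theorem exists_extension_of_place {D F K L : Type*} [CommRing D] [Field F] [Field K] [Field L]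
    [CharZero F] [IsAlgClosed L] [Algebra F K] [FiniteDimensional F K] (j : D →+* K)
    (hj : Function.Injective j) (I : Ideal D) (hI : I ≠ ⊤) (O : ValuationSubring L)
    (ψ : F →+* L)
    (hV : ∀ V : ValuationSubring F, (∀ x d, j d = algebraMap F K x → x ∈ V) →
      (∀ x, ∀ d ∈ I, j d = algebraMap F K x → x ∈ V.nonunits) → V = O.comap ψ) :
    ∃ φ : K →+* L, (∀ x, φ (algebraMap F K x) = ψ x) ∧ ∀ d ∈ I, φ (j d) ∈ O.nonunits := by
  have : Algebra.IsAlgebraic F (AlgebraicClosure K) := Algebra.IsAlgebraic.trans F K _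
  have : IsAlgClosure F (AlgebraicClosure K) := ⟨inferInstance, inferInstance⟩
  have : Normal F (AlgebraicClosure K) := IsAlgClosure.normal F _
  let E := IntermediateField.normalClosure F K (AlgebraicClosure K)
  have : IsGalois F E := {}
  obtain ⟨V, hV1, hV2⟩ := exists_valuationSubring_of_injective ((algebraMap K E).comp j)
    ((algebraMap K E).injective.comp hj) I hI
  let _ : Algebra F L := ψ.toAlgebra
  let ψ₀ : E →ₐ[F] L := IsAlgClosed.lift
  have hcomap : V.comap (algebraMap F E) = (O.comap (ψ₀ : E →+* L)).comap (algebraMap F E) := by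
    rw [ValuationSubring.comap_comap]
    have : (ψ₀ : E →+* L).comp (algebraMap F E) = ψ := RingHom.ext fun x => ψ₀.commutes x
    rw [this]
    refine hV _ (fun x d hxd => ?_) (fun x d hd hxd => ?_)
    · rw [ValuationSubring.mem_comap, IsScalarTower.algebraMap_apply F K E, ← hxd]
      exact hV1 d
    · rw [mem_nonunits_comap_iff, IsScalarTower.algebraMap_apply F K E, ← hxd]
      exact hV2 d hd
  obtain ⟨σ, hσ, hσV⟩ := exists_conjugate_valuationSubring V (O.comap (ψ₀ : E →+* L)) hcomap
  refine ⟨((ψ₀ : E →+* L).comp σ).comp (algebraMap K E), fun x => ?_, fun d hd => ?_⟩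
  · simp only [RingHom.comp_apply]
    rw [← IsScalarTower.algebraMap_apply F K E, hσ]
    exact ψ₀.commutes x
  · exact (mem_nonunits_comap_iff O (ψ₀ : E →+* L)).1 (hσV _ (hV2 d hd))

section RationalFunctions

open Polynomial

/-- If `t` is in the maximal ideal of a valuation ring containing `k`, then a polynomial in `t`
with nonzero constant term has valuation `1`. -/
theorem valuation_aeval_eq_one {k F : Type*} [Field k] [Field F] [Algebra k F]
    (V : ValuationSubring F) (hk : ∀ c : k, algebraMap k F c ∈ V) {t : F} (ht : t ∈ V.nonunits)
    (p : k[X]) (hp : p.coeff 0 ≠ 0) : V.valuation (aeval t p) = 1 := by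
  have h1 : V.valuation (algebraMap k F (p.coeff 0)) = 1 := by
    refine le_antisymm ((V.valuation_le_one_iff _).2 (hk _)) ?_
    have := (V.valuation_le_one_iff _).2 (hk (p.coeff 0)⁻¹)
    rwa [map_inv₀, map_inv₀, inv_le_one₀] at this
    rw [zero_lt_iff, ne_eq, map_eq_zero, map_eq_zero]
    exact hp
  have h2 : V.valuation (t * aeval t p.divX) < 1 := by
    rw [map_mul]
    refine mul_lt_one_of_nonneg_of_lt_one_left zero_le ((V.mem_nonunits_iff).1 ht) ?_
    rw [V.valuation_le_one_iff, aeval_eq_sum_range]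
    refine sum_mem fun i _ => ?_
    rw [Algebra.smul_def]
    exact V.mul_mem _ _ (hk _) (pow_mem (show t ∈ V from V.nonunits_subset ht) _)
  have h3 : aeval t p = t * aeval t p.divX + algebraMap k F (p.coeff 0) := by
    have := congrArg (aeval t) p.X_mul_divX_add
    rw [map_add, map_mul, aeval_X, aeval_C] at this
    exact this.symm
  rw [h3, Valuation.map_add_eq_of_lt_right _ (by rwa [h1]), h1]

theorem exists_valuation_aeval_eq_pow {k : Type*} [Field k] (p : k[X]) (hp : p ≠ 0) :
    ∃ i : ℕ, ∀ {F : Type*} [Field F] [Algebra k F] (V : ValuationSubring F),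
      (∀ c : k, algebraMap k F c ∈ V) → ∀ t ∈ V.nonunits,
      V.valuation (aeval t p) = V.valuation t ^ i := by
  obtain ⟨q, hq, hdvd⟩ := exists_eq_pow_rootMultiplicity_mul_and_not_dvd p hp 0
  refine ⟨p.rootMultiplicity 0, fun V hk t ht => ?_⟩
  have hq0 : q.coeff 0 ≠ 0 := by
    rw [C_0, sub_zero, X_dvd_iff] at hdvd
    exact hdvd
  conv_lhs => rw [hq]
  rw [map_mul, map_mul, valuation_aeval_eq_one V hk ht q hq0]
  simp

/-- On the field `k(t)` there is at most one valuation ring that contains `k` and has `t` in its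
maximal ideal; by symmetry an inclusion is enough. -/
theorem valuationSubring_le_of_mem_nonunits {k F : Type*} [Field k] [Field F] [Algebra k F]
    (V W : ValuationSubring F) (hV : ∀ c : k, algebraMap k F c ∈ V)
    (hW : ∀ c : k, algebraMap k F c ∈ W) {t : F} (ht : t ≠ 0) (htV : t ∈ V.nonunits)
    (htW : t ∈ W.nonunits)
    (hF : ∀ x : F, ∃ p q : k[X], q ≠ 0 ∧ x = aeval t p / aeval t q) : V ≤ W := by
  intro x hx
  obtain ⟨p, q, hq, rfl⟩ := hF x
  rcases eq_or_ne p 0 with rfl | hp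
  · simp
  obtain ⟨i, hi⟩ := exists_valuation_aeval_eq_pow p hp
  obtain ⟨j, hj⟩ := exists_valuation_aeval_eq_pow q hq
  have key : ∀ U : ValuationSubring F, (∀ c : k, algebraMap k F c ∈ U) → t ∈ U.nonunits →
      (aeval t p / aeval t q ∈ U ↔ j ≤ i) := by
    intro U hU htU
    have h0 : 0 < U.valuation t := by rwa [zero_lt_iff, Valuation.ne_zero_iff]
    rw [← U.valuation_le_one_iff, map_div₀, hi U hU t htU, hj U hU t htU,
      div_le_one₀ (pow_pos h0 _), pow_le_pow_iff_right_of_lt_one₀ h0 (U.mem_nonunits_iff.1 htU)]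
  rw [key W hW htW]
  rwa [key V hV htV] at hx

end RationalFunctions

/-! ### A curve through a point of an affine variety -/

/-- Let `A` be the coordinate ring of an affine variety, `a` a point of it and `f ≠ 0` a function.
There is an irreducible subvariety of dimension at most one through `a` on which `f` does not
vanish identically: after Noether normalization, take a component of the preimage of a line.
Going-down, which holds over the integrally closed polynomial ring, provides a component
through `a`. -/
theorem exists_prime_trdeg_quotient_le_one.{u} {k A : Type u} [Field k] [Infinite k] [CommRing A]
    [IsDomain A] [Algebra k A] [Algebra.FiniteType k A] (a : A →ₐ[k] k) (f : A) (hf : f ≠ 0) :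
    ∃ Q : Ideal A, Q.IsPrime ∧ f ∉ Q ∧ Q ≤ RingHom.ker a ∧ Algebra.trdeg k (A ⧸ Q) ≤ 1 := by
  obtain ⟨s, g, hg, hgint⟩ := exists_integral_inj_algHom_of_fg k A
  let R := MvPolynomial (Fin s) k
  let _ : Algebra R A := g.toRingHom.toAlgebra
  have : IsScalarTower k R A := IsScalarTower.of_algebraMap_eq fun x => (g.commutes x).symm
  have : Algebra.IsIntegral R A := ⟨hgint⟩
  have : FaithfulSMul R A := (faithfulSMul_iff_algebraMap_injective R A).2 hg
  -- a polynomial divisible by `f`: where it does not vanish, neither does `f`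
  obtain ⟨F, hF0, hfF⟩ := (Algebra.IsAlgebraic.isAlgebraic (R := R) f).exists_nonzero_dvd
    (mem_nonZeroDivisors_of_ne_zero hf)
  set y₀ : Fin s → k := fun i => a (g (MvPolynomial.X i)) with hy₀
  have hag : ∀ p : R, a (algebraMap R A p) = MvPolynomial.eval y₀ p := by
    have : a.comp g = MvPolynomial.aeval y₀ := MvPolynomial.algHom_ext fun i => by simp [hy₀]
    exact fun p => DFunLike.congr_fun this p
  obtain ⟨y₁, hy₁⟩ : ∃ y₁, MvPolynomial.eval y₁ F ≠ 0 := by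
    by_contra! h
    exact hF0 (MvPolynomial.funext fun y => by simpa using h y)
  -- restriction to the line through `y₀` and `y₁`
  let φ : R →ₐ[k] Polynomial k := MvPolynomial.aeval fun i =>
    Polynomial.C (y₀ i) + Polynomial.X * Polynomial.C (y₁ i - y₀ i)
  have hφ0 : ∀ p, (φ p).eval 0 = MvPolynomial.eval y₀ p := by
    have : (Polynomial.aeval 0).comp φ = MvPolynomial.aeval y₀ :=
      MvPolynomial.algHom_ext fun i => by simp [φ]
    exact fun p => by simpa using! DFunLike.congr_fun this p
  have hφ1 : ∀ p, (φ p).eval 1 = MvPolynomial.eval y₁ p := by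
    have : (Polynomial.aeval 1).comp φ = MvPolynomial.aeval y₁ :=
      MvPolynomial.algHom_ext fun i => by simp [φ]
    exact fun p => by simpa using! DFunLike.congr_fun this p
  let q : Ideal R := RingHom.ker φ
  have hqprime : q.IsPrime := RingHom.ker_isPrime φ
  have hker : (RingHom.ker a).IsPrime := RingHom.ker_isPrime a
  have hq : q ≤ (RingHom.ker a).under R := fun p hp => by
    have hp' : φ p = 0 := hp
    change a (algebraMap R A p) = 0
    rw [hag, ← hφ0, hp', Polynomial.eval_zero]
  obtain ⟨Q, hQa, hQ, hQq⟩ := Ideal.exists_ideal_le_liesOver_of_le (RingHom.ker a)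
    (q := (RingHom.ker a).under R) hq
  refine ⟨Q, hQ, fun hfQ => hy₁ ?_, hQa, ?_⟩
  · have h1 : F ∈ q := by
      rw [hQq.over]
      exact Q.mem_of_dvd hfF hfQ
    rw [← hφ1, show φ F = 0 from h1, Polynomial.eval_zero]
  · have h1 : Algebra.trdeg k (R ⧸ q) ≤ 1 := by
      have := trdeg_le_of_injective (Ideal.kerLiftAlg φ) (Ideal.kerLiftAlg_injective φ)
      rwa [Polynomial.trdeg_of_isDomain] at this
    have : FaithfulSMul k (R ⧸ q) := inferInstance
    have : FaithfulSMul (R ⧸ q) (A ⧸ Q) := inferInstance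
    have : Algebra.IsIntegral (R ⧸ q) (A ⧸ Q) := inferInstance
    have : IsScalarTower k (R ⧸ q) (A ⧸ Q) := inferInstance
    rw [← trdeg_add_eq k (R ⧸ q) (A := A ⧸ Q), trdeg_eq_zero (R := R ⧸ q), add_zero]
    exact h1

open Polynomial in
/-- The case of a curve: any point at which the function `t` vanishes lies on a branch along
which `t` takes the prescribed infinitesimal value `τ`. The function field is finite over `k(t)`,
and `t ↦ τ` embeds `k(t)` into `L`. This embedding extends by `exists_extension_of_place`, because
`k(t)` carries only one valuation ring that contains `k` and has `t` in its maximal ideal. -/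
theorem exists_algHom_specializing_of_trdeg_le_one.{u, v} {k D : Type u} {L : Type v} [Field k]
    [CharZero k] [CommRing D] [IsDomain D] [Algebra k D] [Algebra.FiniteType k D] [Field L]
    [Algebra k L] [IsAlgClosed L] (O : ValuationSubring L) (hO : ∀ c : k, algebraMap k L c ∈ O)
    {τ : L} (hτ : τ ∈ O.nonunits) (hτ0 : τ ≠ 0) (htr : Algebra.trdeg k D ≤ 1) (a : D →ₐ[k] k)
    {t : D} (hat : a t = 0) (ht : t ≠ 0) :
    ∃ φ : D →ₐ[k] L, φ t = τ ∧ ∀ x, a x = 0 → φ x ∈ O.nonunits := by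
  have htrans : Transcendental k t := fun halg => by
    obtain ⟨r, hr, c, hc⟩ := halg.exists_nonzero_dvd (mem_nonZeroDivisors_of_ne_zero ht)
    apply hr
    have := congrArg a hc
    rwa [map_mul, hat, zero_mul, AlgHom.commutes] at this
  have hbasis : IsTranscendenceBasis k fun _ : Unit => t :=
    AlgebraicIndependent.isTranscendenceBasis_of_lift_trdeg_le_of_finite
      (algebraicIndependent_unique_type_iff.2 htrans) (by simpa using htr)
  let _ : Algebra k[X] D := (aeval t).toAlgebra
  have hXD : ∀ p : k[X], algebraMap k[X] D p = aeval t p := fun _ => rfl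
  have : IsScalarTower k k[X] D := IsScalarTower.of_algebraMap_eq fun c => by
    rw [hXD, Polynomial.algebraMap_apply, Algebra.algebraMap_self_apply, aeval_C]
  have halgD : Algebra.IsAlgebraic k[X] D := by
    have halg := hbasis.isAlgebraic
    rw [Set.range_const] at halg
    let e := Polynomial.algEquivOfTranscendental k t htrans
    exact ⟨fun d => (halg.isAlgebraic d).of_ringHom_of_comp_eq (e : k[X] →+* _) (RingHom.id D)
      e.surjective Function.injective_id (by ext <;> simp [e, hXD])⟩
  let K := FractionRing D
  have hinj : Function.Injective (algebraMap k[X] K) := by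
    rw [IsScalarTower.algebraMap_eq k[X] D K]
    exact (IsFractionRing.injective D K).comp (transcendental_iff_injective.1 htrans)
  have : FaithfulSMul k[X] K := (faithfulSMul_iff_algebraMap_injective _ _).2 hinj
  let F := FractionRing k[X]
  let _ : Algebra F K := FractionRing.liftAlgebra k[X] K
  have : IsScalarTower k[X] F K := FractionRing.isScalarTower_liftAlgebra k[X] K
  have : Algebra.IsAlgebraic D K := IsLocalization.isAlgebraic K (nonZeroDivisors D)
  have : Algebra.IsAlgebraic k[X] K := Algebra.IsAlgebraic.trans k[X] D K
  have : Algebra.IsAlgebraic F K := IsFractionRing.comap_isAlgebraic_iff.1 this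
  have : IsScalarTower k F K := IsScalarTower.of_algebraMap_eq fun c => by
    rw [IsScalarTower.algebraMap_apply k k[X] F, ← IsScalarTower.algebraMap_apply k[X] F K,
      IsScalarTower.algebraMap_apply k[X] D K, ← IsScalarTower.algebraMap_apply k k[X] D,
      IsScalarTower.algebraMap_apply k D K]
  have : Algebra.EssFiniteType k K :=
    have : Algebra.EssFiniteType D K :=
      Algebra.EssFiniteType.of_isLocalization K (nonZeroDivisors D)
    Algebra.EssFiniteType.comp k D K
  have : Algebra.EssFiniteType F K := Algebra.EssFiniteType.of_comp k F K
  have : FiniteDimensional F K := Algebra.finite_of_essFiniteType_of_isAlgebraic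
  have : CharZero F := inferInstance
  have hinjL : Function.Injective (aeval τ : k[X] →ₐ[k] L) := by
    rw [injective_iff_map_eq_zero]
    intro p hp
    by_contra hp0
    obtain ⟨i, hi⟩ := exists_valuation_aeval_eq_pow p hp0
    have := hi O hO τ hτ
    rw [hp, map_zero] at this
    exact pow_ne_zero i ((Valuation.ne_zero_iff _).2 hτ0) this.symm
  let ψ : F →+* L :=
    IsFractionRing.lift (A := k[X]) (g := (aeval τ : k[X] →ₐ[k] L).toRingHom) hinjL
  have hψ : ∀ p : k[X], ψ (algebraMap k[X] F p) = aeval τ p := fun p =>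
    IsFractionRing.lift_algebraMap hinjL p
  have hFX : ∀ p : k[X], algebraMap k[X] F p = aeval (algebraMap k[X] F X) p := fun p => by
    rw [aeval_algebraMap_apply, aeval_X_left_apply]
  have hkF : ∀ c : k, algebraMap k F c = algebraMap k[X] F (C c) := fun c =>
    IsScalarTower.algebraMap_apply k k[X] F c
  have hψX : ψ (algebraMap k[X] F X) = τ := by rw [hψ, aeval_X]
  have hX0 : algebraMap k[X] F X ≠ 0 := by simp
  have hFK : ∀ p : k[X], algebraMap F K (algebraMap k[X] F p) = algebraMap D K (aeval t p) :=
    fun p => by rw [← IsScalarTower.algebraMap_apply, IsScalarTower.algebraMap_apply k[X] D K, hXD]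
  have hI : RingHom.ker a ≠ ⊤ := RingHom.ker_ne_top a
  obtain ⟨φ, hφ1, hφ2⟩ := exists_extension_of_place (algebraMap D K) (IsFractionRing.injective D K)
    (RingHom.ker a) hI O ψ (by
      intro V hV1 hV2
      have hkV : ∀ c : k, algebraMap k F c ∈ V := fun c =>
        hV1 _ (aeval t (C c)) (by rw [hkF, hFK])
      have htV : algebraMap k[X] F X ∈ V.nonunits :=
        hV2 _ t hat (by rw [hFK, aeval_X])
      have hkW : ∀ c : k, algebraMap k F c ∈ O.comap ψ := fun c => by
        rw [ValuationSubring.mem_comap, hkF, hψ, aeval_C]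
        exact hO c
      have htW : algebraMap k[X] F X ∈ (O.comap ψ).nonunits := by
        rw [mem_nonunits_comap_iff, hψX]
        exact hτ
      have hquot : ∀ x : F, ∃ p q : k[X], q ≠ 0 ∧
          x = aeval (algebraMap k[X] F X) p / aeval (algebraMap k[X] F X) q := fun x => by
        obtain ⟨p, q, hq, rfl⟩ := IsFractionRing.div_surjective k[X] x
        exact ⟨p, q, nonZeroDivisors.ne_zero hq, by rw [← hFX, ← hFX]⟩
      exact le_antisymm (valuationSubring_le_of_mem_nonunits V _ hkV hkW hX0 htV htW hquot)
        (valuationSubring_le_of_mem_nonunits _ V hkW hkV hX0 htW htV hquot))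
  let Φ : D →+* L := φ.comp (algebraMap D K)
  have hpoly : ∀ p : k[X], φ (algebraMap D K (aeval t p)) = aeval τ p := fun p => by
    rw [← hFK, hφ1, hψ]
  refine ⟨{ Φ with commutes' := fun c => ?_ }, ?_, fun x hx => hφ2 _ hx⟩
  · have := hpoly (C c)
    rwa [aeval_C, aeval_C] at this
  · have := hpoly X
    rwa [aeval_X, aeval_X] at this

/-- Let `a` be a point of the affine variety of `A` at which `f` vanishes, lying on an irreducible
subvariety, given by the prime `P`, on which `f` does not vanish identically. Let `O` be a
valuation ring of an algebraically closed field `L`. For every nonzero `τ` in the maximal ideal of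
`O`, the subvariety has an `L`-valued point that specializes to `a` and at which `f` takes the
value `τ`. -/
theorem exists_algHom_specializing.{u, v} {k A : Type u} {L : Type v} [Field k] [CharZero k]
    [CommRing A] [Algebra k A] [Algebra.FiniteType k A] [Field L] [Algebra k L] [IsAlgClosed L]
    (O : ValuationSubring L) (hO : ∀ c : k, algebraMap k L c ∈ O) {τ : L} (hτ : τ ∈ O.nonunits)
    (hτ0 : τ ≠ 0) (a : A →ₐ[k] k) {f : A} (haf : a f = 0) (P : Ideal A) [P.IsPrime]
    (hfP : f ∉ P) (hPa : P ≤ RingHom.ker a) :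
    ∃ φ : A →ₐ[k] L, φ f = τ ∧ (∀ x ∈ P, φ x = 0) ∧ ∀ x, a x = 0 → φ x ∈ O.nonunits := by
  let a₁ : A ⧸ P →ₐ[k] k := Ideal.Quotient.liftₐ P a hPa
  obtain ⟨Q, hQ, hfQ, hQa, htr⟩ := exists_prime_trdeg_quotient_le_one a₁
    (Ideal.Quotient.mk P f) (fun h => hfP (Ideal.Quotient.eq_zero_iff_mem.1 h))
  obtain ⟨φ, hφ, hφa⟩ := exists_algHom_specializing_of_trdeg_le_one O hO hτ hτ0 htr
    (Ideal.Quotient.liftₐ Q a₁ hQa) (t := Ideal.Quotient.mk Q (Ideal.Quotient.mk P f)) haf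
    (fun h => hfQ (Ideal.Quotient.eq_zero_iff_mem.1 h))
  refine ⟨φ.comp ((Ideal.Quotient.mkₐ k Q).comp (Ideal.Quotient.mkₐ k P)), hφ, fun x hx => ?_,
    fun x hx => hφa _ hx⟩
  change φ (Ideal.Quotient.mk Q (Ideal.Quotient.mk P x)) = 0
  rw [Ideal.Quotient.eq_zero_iff_mem.2 hx, map_zero, map_zero]

/-! ### The Newton–Puiseux theorem -/

open Polynomial in
/-- Over a complete local ring, a monic polynomial whose reduction has a root at `0`, but is not a
power of the variable, has a proper monic factor, namely its Weierstrass polynomial. -/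
theorem exists_monic_dvd_natDegree_lt {A : Type*} [CommRing A] [IsLocalRing A]
    [IsAdicComplete (IsLocalRing.maximalIdeal A) A] {p : A[X]} (hp : p.Monic)
    (h0 : p.coeff 0 ∈ IsLocalRing.maximalIdeal A)
    (hne : ∃ i < p.natDegree, p.coeff i ∉ IsLocalRing.maximalIdeal A) :
    ∃ f : A[X], f.Monic ∧ f ∣ p ∧ 0 < f.natDegree ∧ f.natDegree < p.natDegree := by
  obtain ⟨i, hi, hip⟩ := hne
  have hmap : (p : PowerSeries A).map (IsLocalRing.residue A) ≠ 0 := fun h => by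
    apply hip
    have := congrArg (PowerSeries.coeff i) h
    rwa [PowerSeries.coeff_map, Polynomial.coeff_coe, map_zero,
      IsLocalRing.residue_eq_zero_iff] at this
  obtain ⟨f, h, H⟩ := PowerSeries.exists_isWeierstrassFactorization hmap
  have hdvd : f ∣ p := by
    rw [← Ideal.mem_span_singleton, ← Ideal.Quotient.eq_zero_iff_mem]
    apply H.isDistinguishedAt.algEquivQuotient.injective
    rw [map_zero]
    change Ideal.Quotient.mk _ (p : PowerSeries A) = 0
    rw [Ideal.Quotient.eq_zero_iff_mem, Ideal.mem_span_singleton]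
    exact ⟨h, H.eq_mul⟩
  have hf := H.isDistinguishedAt.monic
  refine ⟨f, hf, hdvd, Nat.pos_of_ne_zero fun hdeg => ?_, ?_⟩
  · have hf1 : f = 1 := hf.natDegree_eq_zero.1 hdeg
    have hu : IsUnit (p : PowerSeries A) := by
      rw [H.eq_mul, hf1, Polynomial.coe_one, one_mul]
      exact H.isUnit
    have := PowerSeries.isUnit_constantCoeff _ hu
    rw [Polynomial.constantCoeff_coe] at this
    exact (IsLocalRing.mem_maximalIdeal _).1 h0 this
  · by_contra hlt
    have : p = f := eq_of_monic_of_dvd_of_natDegree_le hf hp hdvd (not_lt.1 hlt)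
    subst this
    exact hip (H.isDistinguishedAt.mem hi)

namespace Puiseux

variable {K : Type*} [Field K]

theorem isBounded_iff_orderTop {x : Puiseux K} :
    x.IsBounded ↔ 0 ≤ (x : HahnSeries ℚ K).orderTop := by
  rw [HahnSeries.le_orderTop_iff_forall]
  exact forall_congr' fun r => by rw [WithTop.coe_lt_zero]; rfl

theorem orderTop_mul (x y : Puiseux K) : ((x * y : Puiseux K) : HahnSeries ℚ K).orderTop =
    (x : HahnSeries ℚ K).orderTop + (y : HahnSeries ℚ K).orderTop := by
  have := (HahnSeries.addVal ℚ K).map_mul (x : HahnSeries ℚ K) y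
  simpa only [HahnSeries.addVal_apply] using! this

theorem exists_orderTop_eq {x : Puiseux K} (hx : x ≠ 0) :
    ∃ q : ℚ, (x : HahnSeries ℚ K).orderTop = q ∧
      ((x⁻¹ : Puiseux K) : HahnSeries ℚ K).orderTop = (-q : ℚ) := by
  have hx' : (x : HahnSeries ℚ K) ≠ 0 := fun h => hx (Subtype.ext h)
  have hy' : ((x⁻¹ : Puiseux K) : HahnSeries ℚ K) ≠ 0 := fun h =>
    inv_ne_zero hx (Subtype.ext h)
  have h : ((x * x⁻¹ : Puiseux K) : HahnSeries ℚ K).orderTop = 0 := by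
    rw [mul_inv_cancel₀ hx]
    exact HahnSeries.orderTop_one
  rw [orderTop_mul, ← HahnSeries.order_eq_orderTop_of_ne_zero hx',
    ← HahnSeries.order_eq_orderTop_of_ne_zero hy', ← WithTop.coe_add, WithTop.coe_eq_zero] at h
  refine ⟨_, (HahnSeries.order_eq_orderTop_of_ne_zero hx').symm, ?_⟩
  rw [← HahnSeries.order_eq_orderTop_of_ne_zero hy', WithTop.coe_inj]
  linarith

variable (K) in
/-- The valuation ring of bounded Puiseux series. -/
def boundedSubring : ValuationSubring (Puiseux K) where
  carrier := {x | x.IsBounded}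
  mul_mem' {x y} hx hy := by
    rw [Set.mem_ofPred_eq, isBounded_iff_orderTop] at *
    rw [orderTop_mul]
    exact add_nonneg hx hy
  one_mem' := isBounded_iff_orderTop.2 HahnSeries.orderTop_one.ge
  add_mem' {x y} hx hy := fun r hr => by
    change (x : HahnSeries ℚ K).coeff r + (y : HahnSeries ℚ K).coeff r = 0
    rw [show (x : HahnSeries ℚ K).coeff r = 0 from hx r hr,
      show (y : HahnSeries ℚ K).coeff r = 0 from hy r hr, add_zero]
  zero_mem' := fun _ _ => rfl
  neg_mem' {x} hx := fun r hr => by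
    change -(x : HahnSeries ℚ K).coeff r = 0
    rw [show (x : HahnSeries ℚ K).coeff r = 0 from hx r hr, neg_zero]
  mem_or_inv_mem' x := by
    rw [Set.mem_ofPred_eq, Set.mem_ofPred_eq, isBounded_iff_orderTop, isBounded_iff_orderTop]
    rcases eq_or_ne x 0 with rfl | hx
    · left; exact (HahnSeries.orderTop_zero (Γ := ℚ) (R := K)).ge.trans' le_top
    · obtain ⟨q, h1, h2⟩ := exists_orderTop_eq hx
      rw [h1, h2, WithTop.coe_nonneg, WithTop.coe_nonneg, neg_nonneg]
      exact le_total 0 q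

theorem mem_boundedSubring {x : Puiseux K} : x ∈ boundedSubring K ↔ x.IsBounded := Iff.rfl

theorem mem_nonunits_boundedSubring {x : Puiseux K} :
    x ∈ (boundedSubring K).nonunits ↔ 0 < (x : HahnSeries ℚ K).orderTop := by
  rw [ValuationSubring.mem_nonunits_iff_or, mem_boundedSubring, isBounded_iff_orderTop]
  rcases eq_or_ne x 0 with rfl | hx
  · simp
  · obtain ⟨q, h1, h2⟩ := exists_orderTop_eq hx
    rw [h1, h2, WithTop.coe_nonneg, WithTop.coe_pos, neg_nonneg, not_le]
    simp [hx]

/-- The power series in `ε ^ (1 / d)`, as a subring of the Puiseux series. -/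
noncomputable def ofPowerSeries (K : Type*) [Field K] (d : ℕ) (hd : 0 < d) :
    PowerSeries K →+* Puiseux K :=
  ((puiseuxRamify K d hd).comp (HahnSeries.ofPowerSeries ℤ K)).codRestrict (puiseuxSubfield K)
    fun _ => IsPuiseux.of_mem (q := d) (hq := hd) ⟨_, rfl⟩

theorem exists_ofPowerSeries_eq {d : ℕ} (hd : 0 < d) {x : Puiseux K} (hx : x.IsBounded)
    (hxd : (x : HahnSeries ℚ K) ∈ (puiseuxRamify K d hd).fieldRange) :
    x ∈ (ofPowerSeries K d hd).range := by
  obtain ⟨z, hz⟩ := hxd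
  have hcoeff : ∀ i : ℤ, z.coeff i = x.coeff ((i : ℚ) / d) := fun i => by
    rw [coeff, ← hz]
    exact (HahnSeries.embDomain_coeff (a := i)).symm
  refine ⟨PowerSeries.mk fun n => z.coeff n, Subtype.ext ?_⟩
  change puiseuxRamify K d hd _ = _
  rw [← hz]
  congr 1
  ext i
  rcases lt_or_ge i 0 with hi | hi
  · rw [hcoeff, hx _ (div_neg_of_neg_of_pos (by exact_mod_cast hi) (by exact_mod_cast hd)),
      HahnSeries.ofPowerSeries_apply]
    refine HahnSeries.embDomain_of_notMem_range ?_
    rintro ⟨n, hn⟩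
    have : ((n : ℕ) : ℤ) = i := hn
    omega
  · lift i to ℕ using hi
    exact (HahnSeries.ofPowerSeries_apply_coeff _ _).trans (PowerSeries.coeff_mk _ _)

theorem coeff_zero_ofPowerSeries {d : ℕ} (hd : 0 < d) (y : PowerSeries K) :
    (ofPowerSeries K d hd y).coeff 0 = PowerSeries.constantCoeff y := by
  have h1 : (puiseuxRamify K d hd (HahnSeries.ofPowerSeries ℤ K y)).coeff (((0 : ℤ) : ℚ) / d) =
      (HahnSeries.ofPowerSeries ℤ K y).coeff 0 := HahnSeries.embDomain_coeff (a := (0 : ℤ))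
  have h2 : (HahnSeries.ofPowerSeries ℤ K y).coeff ((0 : ℕ) : ℤ) = PowerSeries.coeff 0 y :=
    HahnSeries.ofPowerSeries_apply_coeff _ _
  rw [Int.cast_zero, zero_div] at h1
  exact h1.trans (h2.trans (PowerSeries.coeff_zero_eq_constantCoeff_apply y))

theorem exists_common_denominator (x : ℕ → Puiseux K) (n : ℕ) : ∃ (d : ℕ) (hd : 0 < d),
    ∀ i < n, (x i : HahnSeries ℚ K) ∈ (puiseuxRamify K d hd).fieldRange := by
  induction n with
  | zero => exact ⟨1, one_pos, fun i hi => absurd hi (Nat.not_lt_zero i)⟩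
  | succ n ih =>
    obtain ⟨d, hd, h⟩ := ih
    obtain ⟨e, he, hx⟩ := (x n).2
    have hd' : (d : ℚ) ≠ 0 := by positivity
    have he' : (e : ℚ) ≠ 0 := by positivity
    refine ⟨d * e, Nat.mul_pos hd he, fun i hi => ?_⟩
    rw [mem_puiseuxRamify_iff]
    intro r hr
    rcases Nat.lt_succ_iff_lt_or_eq.1 hi with hi | rfl
    · obtain ⟨j, hj⟩ := (mem_puiseuxRamify_iff d hd _).1 (h i hi) r hr
      exact ⟨j * e, by rw [hj]; push_cast; field_simp⟩
    · obtain ⟨j, hj⟩ := hx r hr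
      exact ⟨j * d, by rw [hj]; push_cast; field_simp⟩

/-- The monomial `ε ^ r`. -/
noncomputable def epsPow (K : Type*) [Field K] (r : ℚ) : Puiseux K :=
  ⟨HahnSeries.single r 1, r.den, r.den_pos, fun s hs => ⟨r.num, by
    by_contra hne
    exact hs (HahnSeries.coeff_single_of_ne (by rwa [r.num_div_den] at hne))⟩⟩

theorem orderTop_epsPow (r : ℚ) : (epsPow K r : HahnSeries ℚ K).orderTop = r :=
  HahnSeries.orderTop_single one_ne_zero

theorem epsPow_ne_zero (r : ℚ) : epsPow K r ≠ 0 := fun h => by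
  have := orderTop_epsPow (K := K) r
  rw [h] at this
  simp at this

theorem orderTop_pow (x : Puiseux K) (q : ℚ) (hx : (x : HahnSeries ℚ K).orderTop = q) (n : ℕ) :
    ((x ^ n : Puiseux K) : HahnSeries ℚ K).orderTop = (n * q : ℚ) := by
  induction n with
  | zero => simp
  | succ n ih =>
    rw [pow_succ, orderTop_mul, ih, hx, ← WithTop.coe_add]
    congr 1
    push_cast
    ring

end Puiseux

namespace Puiseux

open Polynomial

variable {K : Type*} [Field K]

/-- The inductive step of the Newton–Puiseux theorem, for a polynomial with bounded coefficients
whose reduction is not the power of a linear polynomial. -/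
theorem exists_monic_natDegree_lt_of_isBounded [IsAlgClosed K] [CharZero K] {p : (Puiseux K)[X]}
    (hp : p.Monic) (hn : p.natDegree ≠ 0) (hbdd : ∀ i, (p.coeff i).IsBounded)
    (hnext : p.coeff (p.natDegree - 1) = 0) (hne : ∃ i < p.natDegree, (p.coeff i).coeff 0 ≠ 0) :
    ∃ f : (Puiseux K)[X], f.Monic ∧ f.natDegree ≠ 0 ∧ f.natDegree < p.natDegree ∧
      ∀ x, f.eval x = 0 → ∃ y, p.eval y = 0 := by
  obtain ⟨d, hd, hcd⟩ := exists_common_denominator p.coeff (p.natDegree + 1)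
  set φ := ofPowerSeries K d hd with hφ
  have hlift : p ∈ lifts φ := by
    rw [lifts_iff_coeff_lifts]
    intro i
    rcases lt_or_ge i (p.natDegree + 1) with hi | hi
    · exact exists_ofPowerSeries_eq hd (hbdd i) (hcd i hi)
    · exact ⟨0, by rw [map_zero, coeff_eq_zero_of_natDegree_lt hi]⟩
  obtain ⟨P, hPp, hPdeg, hP⟩ := lifts_and_natDegree_eq_and_monic hlift hp
  have hcoeff : ∀ i, PowerSeries.constantCoeff (P.coeff i) = (p.coeff i).coeff 0 := fun i => by
    rw [← hPp, coeff_map, hφ, coeff_zero_ofPowerSeries]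
  set Pbar : K[X] := P.map PowerSeries.constantCoeff with hPbar
  have hPbarM : Pbar.Monic := hP.map _
  have hPbardeg : Pbar.natDegree = p.natDegree := by rw [hPbar, hP.natDegree_map, hPdeg]
  obtain ⟨c, hc⟩ := IsAlgClosed.exists_root Pbar (by
    rw [degree_eq_natDegree hPbarM.ne_zero, hPbardeg]
    exact_mod_cast hn)
  -- move a root of the reduction to `0`
  set P₁ : (PowerSeries K)[X] := P.comp (X + C (PowerSeries.C c)) with hP₁
  have hP₁M : P₁.Monic := hP.comp_X_add_C _
  have hP₁deg : P₁.natDegree = p.natDegree := by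
    rw [hP₁, natDegree_comp, natDegree_X_add_C, mul_one, hPdeg]
  have hmem : ∀ y : PowerSeries K, y ∈ IsLocalRing.maximalIdeal (PowerSeries K) ↔
      PowerSeries.constantCoeff y = 0 := fun y => by
    rw [PowerSeries.maximalIdeal_eq_span_X, Ideal.mem_span_singleton, PowerSeries.X_dvd_iff]
  have hP₁map : P₁.map PowerSeries.constantCoeff = Pbar.comp (X + C c) := by
    rw [hP₁, Polynomial.map_comp, hPbar]
    simp
  have : IsAdicComplete (IsLocalRing.maximalIdeal (PowerSeries K)) (PowerSeries K) := by
    rw [PowerSeries.maximalIdeal_eq_span_X]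
    infer_instance
  obtain ⟨f, hf, hfP, hf0, hflt⟩ := exists_monic_dvd_natDegree_lt hP₁M (by
    rw [hmem, ← coeff_map, hP₁map, coeff_zero_eq_eval_zero, eval_comp]
    simpa using hc) (by
    by_contra! hall
    rw [hP₁deg] at hall
    have hpow : Pbar.comp (X + C c) = X ^ p.natDegree := by
      rw [← hP₁map]
      ext i
      rw [coeff_map, coeff_X_pow]
      rcases lt_trichotomy i p.natDegree with hi | hi | hi
      · rw [if_neg hi.ne, (hmem _).1 (hall i hi)]
      · rw [if_pos hi, hi, ← hP₁deg, hP₁M.coeff_natDegree, map_one]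
      · rw [if_neg hi.ne', coeff_eq_zero_of_natDegree_lt (hP₁deg ▸ hi), map_zero]
    have hPbarpow : Pbar = (X - C c) ^ p.natDegree := by
      have := congrArg (fun q => q.comp (X - C c)) hpow
      simpa [comp_assoc] using this
    -- the sum of the roots of the reduction vanishes
    have hc0 : c = 0 := by
      have h1 : Pbar.coeff (p.natDegree - 1) = 0 := by
        rw [hPbar, coeff_map, hcoeff, hnext]
        rfl
      rw [hPbarpow, sub_eq_add_neg, ← C_neg, coeff_X_add_C_pow,
        Nat.sub_sub_self (Nat.one_le_iff_ne_zero.2 hn), pow_one,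
        Nat.choose_symm (Nat.one_le_iff_ne_zero.2 hn), Nat.choose_one_right] at h1
      simpa [hn] using h1
    obtain ⟨i, hi, hi0⟩ := hne
    apply hi0
    rw [← hcoeff, ← coeff_map, ← hPbar, hPbarpow, hc0, C_0, sub_zero, coeff_X_pow, if_neg hi.ne])
  refine ⟨f.map φ, hf.map _, ?_, ?_, fun x hx => ⟨x + φ (PowerSeries.C c), ?_⟩⟩
  · rw [hf.natDegree_map]; exact hf0.ne'
  · rw [hf.natDegree_map]; exact hflt.trans_eq hP₁deg
  · have h1 : (P₁.map φ).eval x = 0 := by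
      obtain ⟨h, hh⟩ := hfP
      rw [hh, Polynomial.map_mul, eval_mul, hx, zero_mul]
    rw [hP₁, Polynomial.map_comp, hPp] at h1
    simpa using h1

theorem coeff_comp_X_add_C_natDegree_sub_one {R : Type*} [CommRing R] {p : R[X]} (hp : p.Monic)
    (hn : p.natDegree ≠ 0) (r : R) : (p.comp (X + C r)).coeff (p.natDegree - 1) =
      p.natDegree * r + p.coeff (p.natDegree - 1) := by
  have h1 : p.natDegree - 1 + 1 = p.natDegree := Nat.succ_pred_eq_of_ne_zero hn
  have h2 : (hasseDeriv (p.natDegree - 1) p).natDegree ≤ 1 :=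
    (natDegree_hasseDeriv_le p _).trans (by omega)
  rw [← taylor_apply, taylor_coeff, eq_X_add_C_of_natDegree_le_one h2, hasseDeriv_coeff,
    hasseDeriv_coeff, add_comm 1, h1, hp.coeff_natDegree,
    Nat.choose_symm (Nat.one_le_iff_ne_zero.2 hn)]
  simp

/-- By induction on the degree. Once the second coefficient is removed, scaling the roots by a power
of `ε` makes the coefficients bounded, some coefficient other than the leading one being a unit.
The reduction is then no power of a linear polynomial, so there is a factor of smaller degree. -/
theorem exists_root_of_monic [IsAlgClosed K] [CharZero K] (n : ℕ) : ∀ p : (Puiseux K)[X],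
    p.Monic → p.natDegree = n → n ≠ 0 → ∃ x, p.eval x = 0 := by
  induction n using Nat.strong_induction_on with
  | _ n ih =>
  classical
  intro p hp hpn hn
  have : CharZero (Puiseux K) := charZero_of_injective_ringHom (const K).injective
  -- remove the second coefficient
  set r : Puiseux K := -(p.coeff (n - 1) / n) with hr
  set q := p.comp (X + C r) with hq
  have hqM : q.Monic := hp.comp_X_add_C _
  have hqn : q.natDegree = n := by rw [hq, natDegree_comp, natDegree_X_add_C, mul_one, hpn]
  have hqnext : q.coeff (n - 1) = 0 := by
    have := coeff_comp_X_add_C_natDegree_sub_one hp (by rwa [hpn]) r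
    rw [hpn] at this
    rw [hq, this, hr]
    have : (n : Puiseux K) ≠ 0 := by exact_mod_cast hn
    field_simp
    ring
  suffices h : ∃ x, q.eval x = 0 by
    obtain ⟨x, hx⟩ := h
    exact ⟨x + r, by simpa [hq] using hx⟩
  by_cases hall : ∀ i < n, q.coeff i = 0
  · exact ⟨0, by rw [← coeff_zero_eq_eval_zero]; exact hall 0 (Nat.pos_of_ne_zero hn)⟩
  push Not at hall
  obtain ⟨j, hj, hj0⟩ := hall
  have hord : ∀ i, ∃ o : ℚ, q.coeff i ≠ 0 →
      (q.coeff i : HahnSeries ℚ K).orderTop = o := fun i => by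
    by_cases h : q.coeff i = 0
    · exact ⟨0, fun h' => absurd h h'⟩
    · obtain ⟨o, ho, -⟩ := exists_orderTop_eq h
      exact ⟨o, fun _ => ho⟩
  choose o ho using hord
  -- the first slope of the Newton polygon
  obtain ⟨i₀, hi₀, hmin⟩ := ((Finset.range n).filter fun i => q.coeff i ≠ 0).exists_min_image
    (fun i => o i / ((n - i : ℕ) : ℚ)) ⟨j, by simp [hj, hj0]⟩
  rw [Finset.mem_filter, Finset.mem_range] at hi₀
  set s : ℚ := o i₀ / ((n - i₀ : ℕ) : ℚ) with hs
  set q' := q.scaleRoots (epsPow K (-s)) with hq'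
  have horder : ∀ i < n, q.coeff i ≠ 0 → (q'.coeff i : HahnSeries ℚ K).orderTop =
      (o i - (n - i : ℕ) * s : ℚ) := fun i hi h0 => by
    rw [hq', coeff_scaleRoots, hqn, orderTop_mul, ho i h0,
      orderTop_pow _ (-s) (orderTop_epsPow _), ← WithTop.coe_add]
    congr 1
    ring
  have hq'n : q'.natDegree = n := by rw [hq', natDegree_scaleRoots, hqn]
  have hq'M : q'.Monic := (monic_scaleRoots_iff _).2 hqM
  have hbdd : ∀ i, (q'.coeff i).IsBounded := fun i => by
    rcases lt_trichotomy i n with hi | hi | hi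
    · by_cases h0 : q.coeff i = 0
      · rw [hq', coeff_scaleRoots, h0, zero_mul]
        exact (boundedSubring K).zero_mem
      · rw [isBounded_iff_orderTop, horder i hi h0, WithTop.coe_nonneg, sub_nonneg]
        have h1 := hmin i (by simp [hi, h0])
        have h2 : (0 : ℚ) < ((n - i : ℕ) : ℚ) := by exact_mod_cast Nat.sub_pos_of_lt hi
        rw [le_div_iff₀ h2] at h1
        rw [mul_comm]
        exact h1
    · have : q'.coeff i = 1 := by rw [hi, ← hq'n]; exact hq'M
      rw [this]
      exact (boundedSubring K).one_mem
    · rw [coeff_eq_zero_of_natDegree_lt (hq'n ▸ hi)]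
      exact (boundedSubring K).zero_mem
  obtain ⟨f, hf, hf0, hflt, hroot⟩ := exists_monic_natDegree_lt_of_isBounded hq'M
    (by rwa [hq'n]) hbdd
    (by rw [hq'n, hq', coeff_scaleRoots, hqnext, zero_mul])
    ⟨i₀, by rw [hq'n]; exact hi₀.1, by
      have h1 := horder i₀ hi₀.1 hi₀.2
      have h2 : ((n - i₀ : ℕ) : ℚ) ≠ 0 := by
        exact_mod_cast (Nat.sub_pos_of_lt hi₀.1).ne'
      rw [hs, mul_div_cancel₀ _ h2, sub_self] at h1
      exact HahnSeries.coeff_orderTop_ne h1⟩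
  rw [hq'n] at hflt
  obtain ⟨x, hx⟩ := ih _ hflt f hf rfl hf0
  obtain ⟨y, hy⟩ := hroot x hx
  have hε := epsPow_ne_zero (K := K) (-s)
  refine ⟨(epsPow K (-s))⁻¹ * y, ?_⟩
  have := scaleRoots_eval_mul q ((epsPow K (-s))⁻¹ * y) (epsPow K (-s))
  rw [mul_inv_cancel_left₀ hε, ← hq', hy] at this
  exact (mul_eq_zero.1 this.symm).resolve_left (pow_ne_zero _ hε)

/-- **Newton–Puiseux theorem.** -/
instance [IsAlgClosed K] [CharZero K] : IsAlgClosed (Puiseux K) :=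
  IsAlgClosed.of_exists_root _ fun p hp hirr =>
    exists_root_of_monic p.natDegree p hp rfl hirr.natDegree_pos.ne'

end Puiseux

/-! ### Germs along an ultrafilter -/

namespace Filter.Germ

/-- The field of germs along an ultrafilter of functions to an algebraically closed field is
algebraically closed: a root of a monic polynomial is chosen pointwise. -/
theorem isAlgClosed_ultrafilter {α β : Type*} [Field β] [IsAlgClosed β] (U : Ultrafilter α) :
    IsAlgClosed (Germ (U : Filter α) β) := by
  refine IsAlgClosed.of_exists_root _ fun p hp hirr => ?_
  have hn := hirr.natDegree_pos
  have hc : ∀ i, ∃ c : α → β, coeRingHom (U : Filter α) c = p.coeff i := fun i =>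
    Germ.inductionOn (p.coeff i) fun c => ⟨c, rfl⟩
  choose c hc using hc
  have hroot : ∀ t, ∃ z : β, z ^ p.natDegree + ∑ i : Fin p.natDegree, c i t * z ^ (i : ℕ) = 0 := by
    intro t
    have hdeg := Polynomial.degree_sum_fin_lt fun i : Fin p.natDegree => c i t
    have hm := Polynomial.monic_X_pow_add hdeg
    obtain ⟨z, hz⟩ := IsAlgClosed.exists_root _ (by
      rw [Polynomial.degree_add_eq_left_of_degree_lt (by rwa [Polynomial.degree_X_pow]),
        Polynomial.degree_X_pow]
      exact_mod_cast hn.ne' :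
      (Polynomial.X ^ p.natDegree + ∑ i : Fin p.natDegree,
        Polynomial.C (c i t) * Polynomial.X ^ (i : ℕ)).degree ≠ 0)
    refine ⟨z, ?_⟩
    simpa [Polynomial.eval_finsetSum] using hz
  choose z hz using hroot
  refine ⟨coeRingHom (U : Filter α) z, ?_⟩
  have h0 : z ^ p.natDegree + ∑ i : Fin p.natDegree, c i * z ^ (i : ℕ) = 0 := by
    ext t
    simpa using hz t
  have h1 := congrArg (coeRingHom (U : Filter α)) h0
  rw [hp.as_sum]
  simp only [map_add, map_pow, map_sum, map_mul, hc, map_zero] at h1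
  simpa [Polynomial.eval_finsetSum, Finset.sum_range] using h1

/-- The valuation ring of bounded germs along an ultrafilter. -/
def boundedSubring {α 𝕜 : Type*} [NormedField 𝕜] (U : Ultrafilter α) :
    ValuationSubring (Germ (U : Filter α) 𝕜) where
  carrier := {g | ∃ C : ℝ, g.LiftPred fun z => ‖z‖ ≤ C}
  mul_mem' {g h} := by
    refine Germ.inductionOn₂ g h fun u v => ?_
    rintro ⟨C, hC⟩ ⟨D, hD⟩
    refine ⟨C * D, ?_⟩
    rw [liftPred_coe] at hC hD
    rw [← coe_mul, liftPred_coe]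
    filter_upwards [hC, hD] with t h1 h2
    rw [Pi.mul_apply, norm_mul]
    exact mul_le_mul h1 h2 (norm_nonneg _) ((norm_nonneg _).trans h1)
  one_mem' := ⟨1, liftPred_const (norm_one (α := 𝕜)).le⟩
  add_mem' {g h} := by
    refine Germ.inductionOn₂ g h fun u v => ?_
    rintro ⟨C, hC⟩ ⟨D, hD⟩
    refine ⟨C + D, ?_⟩
    rw [liftPred_coe] at hC hD
    rw [← coe_add, liftPred_coe]
    filter_upwards [hC, hD] with t h1 h2
    exact (norm_add_le _ _).trans (add_le_add h1 h2)
  zero_mem' := ⟨0, liftPred_const (norm_zero (E := 𝕜)).le⟩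
  neg_mem' {g} := by
    refine Germ.inductionOn g fun u => ?_
    rintro ⟨C, hC⟩
    refine ⟨C, ?_⟩
    rw [liftPred_coe] at hC
    rw [← coe_neg, liftPred_coe]
    filter_upwards [hC] with t h1
    rwa [Pi.neg_apply, norm_neg]
  mem_or_inv_mem' g := by
    refine Germ.inductionOn g fun u => ?_
    rcases U.eventually_or.1 (Eventually.of_forall fun t => le_total ‖u t‖ 1) with h | h
    · exact Or.inl ⟨1, h⟩
    · refine Or.inr ⟨1, ?_⟩
      rw [← coe_inv, liftPred_coe]
      filter_upwards [h] with t ht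
      rw [Pi.inv_apply, norm_inv]
      exact inv_le_one_of_one_le₀ ht

theorem const_mem_boundedSubring {α 𝕜 : Type*} [NormedField 𝕜] (U : Ultrafilter α) (c : 𝕜) :
    (↑c : Germ (U : Filter α) 𝕜) ∈ boundedSubring U :=
  ⟨‖c‖, liftPred_const le_rfl⟩

/-- The maximal ideal of the ring of bounded germs consists of the infinitesimal germs. -/
theorem coe_mem_nonunits_boundedSubring {α 𝕜 : Type*} [NormedField 𝕜] {U : Ultrafilter α}
    {u : α → 𝕜} : (↑u : Germ (U : Filter α) 𝕜) ∈ (boundedSubring U).nonunits ↔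
      ∀ δ > 0, ∀ᶠ t in U, ‖u t‖ < δ := by
  rw [ValuationSubring.mem_nonunits_iff_or]
  constructor
  · rintro (h | h) δ hδ
    · have h' : u =ᶠ[U] 0 := coe_eq.1 h
      filter_upwards [h'] with t ht
      simpa [ht] using hδ
    · by_contra hcon
      rw [← U.eventually_not] at hcon
      refine h ⟨δ⁻¹, ?_⟩
      rw [← coe_inv, liftPred_coe]
      filter_upwards [hcon] with t ht
      rw [Pi.inv_apply, norm_inv]
      exact inv_anti₀ hδ (not_lt.1 ht)
  · intro h
    by_contra! hcon
    obtain ⟨h0, C, hC⟩ := hcon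
    rw [← coe_inv, liftPred_coe] at hC
    have h0' : ∀ᶠ t in U, u t ≠ 0 := by
      rw [U.eventually_not]
      exact fun h => h0 (coe_eq.2 h)
    obtain ⟨t, ht1, ht2, ht3⟩ := (h0'.and (hC.and (h (|C| + 1)⁻¹ (by positivity)))).exists
    rw [Pi.inv_apply, norm_inv] at ht2
    have hpos : 0 < ‖u t‖ := norm_pos_iff.2 ht1
    rw [lt_inv_comm₀ hpos (by positivity)] at ht3
    linarith [le_abs_self C]

end Filter.Germ

/-! ### Specialization of points of a family of fibres -/

section Specialization

open MvPolynomial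

variable {k L : Type*} [Field k] [Field L] {n m : ℕ}

/-- Evaluation of polynomials commutes with specialization. -/
theorem eval₂_sub_mem_nonunits (O : ValuationSubring L) (ι : k →+* L) (hO : ∀ c, ι c ∈ O)
    {a : Fin n → k} {x : Fin n → L} (hx : ∀ i, x i - ι (a i) ∈ O.nonunits)
    (p : MvPolynomial (Fin n) k) : eval₂ ι x p - ι (eval a p) ∈ O.nonunits := by
  have hmul : ∀ y ∈ O.nonunits, ∀ z ∈ O, y * z ∈ O.nonunits := fun y hy z hz => by
    rw [O.mem_nonunits_iff] at hy ⊢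
    rw [map_mul]
    exact mul_lt_one_of_nonneg_of_lt_one_left zero_le hy ((O.valuation_le_one_iff _).2 hz)
  have hxO : ∀ i, x i ∈ O := fun i => by
    have := O.add_mem _ _ (O.nonunits_subset (hx i)) (hO (a i))
    rwa [sub_add_cancel] at this
  induction p using MvPolynomial.induction_on with
  | C c => simp
  | add p q hp hq =>
    have := add_mem hp hq
    simp only [eval₂_add, map_add]
    convert this using 1
    ring
  | mul_X p i hp =>
    have := add_mem (hmul _ hp _ (hxO i)) (hmul _ (hx i) _ (hO (eval a p)))
    simp only [eval₂_mul, eval₂_X, map_mul, eval_X]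
    convert this using 1
    ring

theorem eq_zero_of_mem_nonunits (O : ValuationSubring L) (ι : k →+* L) (hO : ∀ c, ι c ∈ O) {c : k}
    (hc : ι c ∈ O.nonunits) : c = 0 := by
  rw [O.mem_nonunits_iff_or] at hc
  rcases hc with h | h
  · exact (map_eq_zero ι).1 h
  · exact absurd (map_inv₀ ι c ▸ hO c⁻¹) h

/-- The point `a` lies on the hypersurface `F = 0` and in the Zariski closure of the part of
`V(G)` where `F` does not vanish; the closure is expressed by the saturation of the ideal `(G)`
with respect to `F`. -/
def IsLimitPoint (F : MvPolynomial (Fin n) k) (G : Fin m → MvPolynomial (Fin n) k)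
    (a : Fin n → k) : Prop :=
  eval a F = 0 ∧ ∀ (N : ℕ) (p : MvPolynomial (Fin n) k),
    F ^ N * p ∈ Ideal.span (Set.range G) → eval a p = 0

theorem eval₂_eq_zero_of_mem_span {ι : k →+* L} {x : Fin n → L} {F : MvPolynomial (Fin n) k}
    {G : Fin m → MvPolynomial (Fin n) k} (hF : eval₂ ι x F ≠ 0) (hG : ∀ j, eval₂ ι x (G j) = 0)
    {N : ℕ} {p : MvPolynomial (Fin n) k} (hp : F ^ N * p ∈ Ideal.span (Set.range G)) :
    eval₂ ι x p = 0 := by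
  have hle : Ideal.span (Set.range G) ≤ RingHom.ker (eval₂Hom ι x) := by
    rw [Ideal.span_le]
    rintro _ ⟨j, rfl⟩
    exact hG j
  have h : eval₂Hom ι x (F ^ N * p) = 0 := hle hp
  rw [map_mul, map_pow] at h
  exact (mul_eq_zero.1 h).resolve_left (pow_ne_zero N hF)

/-- If a point of `V(G)` at which `F` takes a nonzero infinitesimal value specializes to `a`, then
`a` is a limit point. -/
theorem IsLimitPoint.of_specializing {O : ValuationSubring L} {ι : k →+* L} (hO : ∀ c, ι c ∈ O)
    {F : MvPolynomial (Fin n) k} {G : Fin m → MvPolynomial (Fin n) k} {a : Fin n → k}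
    {x : Fin n → L} (hF : eval₂ ι x F ∈ O.nonunits) (hF0 : eval₂ ι x F ≠ 0)
    (hG : ∀ j, eval₂ ι x (G j) = 0) (hx : ∀ i, x i - ι (a i) ∈ O.nonunits) :
    IsLimitPoint F G a := by
  refine ⟨eq_zero_of_mem_nonunits O ι hO ?_, fun N p hp => eq_zero_of_mem_nonunits O ι hO ?_⟩
  · simpa using sub_mem hF (eval₂_sub_mem_nonunits O ι hO hx F)
  · have := eval₂_sub_mem_nonunits O ι hO hx p
    rw [eval₂_eq_zero_of_mem_span hF0 hG hp, zero_sub] at this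
    simpa using neg_mem this

/-- Every limit point is the specialization of a point of the fibre of `F` over any given nonzero
element of the maximal ideal. -/
theorem IsLimitPoint.exists_specializing [CharZero k] [IsAlgClosed L] (O : ValuationSubring L)
    (ι : k →+* L) (hO : ∀ c, ι c ∈ O) {τ : L} (hτ : τ ∈ O.nonunits) (hτ0 : τ ≠ 0)
    {F : MvPolynomial (Fin n) k} {G : Fin m → MvPolynomial (Fin n) k} {a : Fin n → k}
    (ha : IsLimitPoint F G a) :
    ∃ x : Fin n → L, eval₂ ι x F = τ ∧ (∀ j, eval₂ ι x (G j) = 0) ∧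
      ∀ i, x i - ι (a i) ∈ O.nonunits := by
  have hker : (RingHom.ker (eval a)).IsPrime := RingHom.ker_isPrime _
  -- a prime ideal disjoint from `S` does not contain `F` and is contained in the ideal of `a`
  let S : Submonoid (MvPolynomial (Fin n) k) :=
    Submonoid.powers F ⊔ (RingHom.ker (eval a)).primeCompl
  have hS : Disjoint (Ideal.span (Set.range G) : Set (MvPolynomial (Fin n) k)) S := by
    rw [Set.disjoint_left]
    intro p hp hpS
    obtain ⟨_, ⟨N, rfl⟩, q, hq, rfl⟩ := Submonoid.mem_sup.1 hpS
    exact hq (ha.2 N q hp)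
  obtain ⟨P, hP, hGP, hPS⟩ := Ideal.exists_le_prime_disjoint _ S hS
  have hFP : F ∉ P := fun h => Set.disjoint_left.1 hPS h
    ((le_sup_left : Submonoid.powers F ≤ S) (Submonoid.mem_powers F))
  have hPa : P ≤ RingHom.ker (aeval a : MvPolynomial (Fin n) k →ₐ[k] k) := fun p hp => by
    by_contra hpa
    exact Set.disjoint_left.1 hPS hp
      ((le_sup_right : (RingHom.ker (eval a)).primeCompl ≤ S) fun h => hpa h)
  let _ : Algebra k L := ι.toAlgebra
  have hev : ∀ (φ : MvPolynomial (Fin n) k →ₐ[k] L) p, φ p = eval₂ ι (fun i => φ (X i)) p :=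
    fun φ p => DFunLike.congr_fun (aeval_unique φ) p
  obtain ⟨φ, hφF, hφP, hφ⟩ :=
    exists_algHom_specializing O hO hτ hτ0 (aeval a) (f := F) ha.1 P hFP hPa
  refine ⟨fun i => φ (X i), by rw [← hev, hφF], fun j => ?_, fun i => ?_⟩
  · rw [← hev]
    exact hφP _ (hGP (Ideal.subset_span ⟨j, rfl⟩))
  · have := hφ (X i - C (a i)) (by simp)
    rwa [map_sub, hev φ (C (a i)), eval₂_C] at this

end Specialization

/-! ### The two limits -/

/-- A Puiseux series specializes to `c` in the sense of valuations if and only if it is bounded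
with constant term `c`. -/
theorem Puiseux.sub_const_mem_nonunits {K : Type*} [Field K] {x : Puiseux K} {c : K} :
    x - Puiseux.const K c ∈ (Puiseux.boundedSubring K).nonunits ↔
      x.IsBounded ∧ x.coeff 0 = c := by
  have hcoeff : ∀ r, ((x - Puiseux.const K c : Puiseux K) : HahnSeries ℚ K).coeff r =
      x.coeff r - (HahnSeries.C c : HahnSeries ℚ K).coeff r := fun _ => rfl
  have hC : ∀ r : ℚ, r ≠ 0 → (HahnSeries.C c : HahnSeries ℚ K).coeff r = 0 := fun r hr =>
    HahnSeries.coeff_single_of_ne hr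
  have hC0 : (HahnSeries.C c : HahnSeries ℚ K).coeff 0 = c := HahnSeries.coeff_single_same _ _
  rw [Puiseux.mem_nonunits_boundedSubring]
  constructor
  · intro h
    have h' : ∀ r : ℚ, r ≤ 0 → x.coeff r = (HahnSeries.C c : HahnSeries ℚ K).coeff r :=
      fun r hr => sub_eq_zero.1 ((hcoeff r).symm.trans (HahnSeries.coeff_eq_zero_of_lt_orderTop
        (lt_of_le_of_lt (by exact_mod_cast hr) h)))
    exact ⟨fun r hr => by rw [h' r hr.le, hC r hr.ne], by rw [h' 0 le_rfl, hC0]⟩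
  · rintro ⟨h1, h2⟩
    by_contra hlt
    rw [not_lt, ← not_lt] at hlt
    rcases eq_or_ne (x - Puiseux.const K c) 0 with h0 | h0
    · rw [h0] at hlt
      simp at hlt
    obtain ⟨q, hq, -⟩ := Puiseux.exists_orderTop_eq h0
    rw [hq, WithTop.coe_pos, not_lt] at hlt
    refine HahnSeries.coeff_orderTop_ne hq ?_
    rw [hcoeff]
    rcases hlt.lt_or_eq with h | rfl
    · rw [h1 q h, hC q h.ne, sub_zero]
    · rw [h2, hC0, sub_self]

section RealFibers

open MvPolynomial Filter Topology

variable {n m : ℕ} (f : MvPolynomial (Fin n) ℝ) (g : Fin m → MvPolynomial (Fin n) ℝ)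

theorem mem_fiberSet_comp_iff {K : Type*} [Field K] (ι : ℂ →+* K) (c : K) (x : Fin n → K) :
    x ∈ fiberSet (ι.comp Complex.ofRealHom) f g c ↔ eval₂ ι x (map Complex.ofRealHom f) = c ∧
      ∀ j, eval₂ ι x (map Complex.ofRealHom (g j)) = 0 := by
  simp only [fiberSet, eval₂_map, sub_eq_zero, Set.mem_ofPred_eq]

theorem mem_fiberSet_ofRealHom_iff (c : ℂ) (x : Fin n → ℂ) :
    x ∈ fiberSet Complex.ofRealHom f g c ↔ eval x (map Complex.ofRealHom f) = c ∧
      ∀ j, eval x (map Complex.ofRealHom (g j)) = 0 :=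
  mem_fiberSet_comp_iff f g (RingHom.id ℂ) c x

theorem Puiseux.eps_mem_nonunits (K : Type*) [Field K] :
    Puiseux.eps K ∈ (Puiseux.boundedSubring K).nonunits := by
  have h : ((Puiseux.eps K : Puiseux K) : HahnSeries ℚ K).orderTop = (1 : ℚ) :=
    HahnSeries.orderTop_single (one_ne_zero (α := K))
  rw [Puiseux.mem_nonunits_boundedSubring, h]
  exact WithTop.coe_pos.2 one_pos

theorem Puiseux.eps_ne_zero (K : Type*) [Field K] : Puiseux.eps K ≠ 0 :=
  Puiseux.epsPow_ne_zero 1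

theorem Puiseux.const_mem_boundedSubring {K : Type*} [Field K] (c : K) :
    Puiseux.const K c ∈ Puiseux.boundedSubring K :=
  fun _ hr => HahnSeries.coeff_single_of_ne hr.ne

/-- The limit of the fibre over `ε` consists of the limit points, since the field of Puiseux series
is algebraically closed and `ε` is infinitesimal. -/
theorem mem_limitSet_fiberSet_iff (a : Fin n → ℂ) :
    a ∈ Puiseux.limitSet (fiberSet ((Puiseux.const ℂ).comp Complex.ofRealHom) f g
        (Puiseux.eps ℂ)) ↔
      IsLimitPoint (map Complex.ofRealHom f) (fun j => map Complex.ofRealHom (g j)) a := by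
  constructor
  · rintro ⟨x, hx, hxa⟩
    obtain ⟨hxf, hxg⟩ := (mem_fiberSet_comp_iff f g _ _ x).1 hx
    exact IsLimitPoint.of_specializing (O := Puiseux.boundedSubring ℂ)
      Puiseux.const_mem_boundedSubring (hxf ▸ Puiseux.eps_mem_nonunits ℂ)
      (hxf ▸ Puiseux.eps_ne_zero ℂ) hxg fun i => Puiseux.sub_const_mem_nonunits.2 (hxa i)
  · intro ha
    obtain ⟨x, hxf, hxg, hxa⟩ := ha.exists_specializing (Puiseux.boundedSubring ℂ)
      (Puiseux.const ℂ) Puiseux.const_mem_boundedSubring (Puiseux.eps_mem_nonunits ℂ)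
      (Puiseux.eps_ne_zero ℂ)
    exact ⟨x, (mem_fiberSet_comp_iff f g _ _ x).2 ⟨hxf, hxg⟩,
      fun i => Puiseux.sub_const_mem_nonunits.1 (hxa i)⟩

/-- A point approached by the fibres over `tξ` for arbitrarily small `t` is a limit point. -/
theorem isLimitPoint_of_frequently {F : MvPolynomial (Fin n) ℂ}
    {G : Fin m → MvPolynomial (Fin n) ℂ} {a : Fin n → ℂ} {ξ : ℂ} (hξ : ξ ≠ 0)
    (h : ∀ U ∈ 𝓝 a, ∃ᶠ t : ℝ in 𝓝[>] 0,
      ∃ y ∈ U, eval y F = t * ξ ∧ ∀ j, eval y (G j) = 0) : IsLimitPoint F G a := by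
  have hcont : ∀ p : MvPolynomial (Fin n) ℂ, Continuous fun y => eval y p := fun p =>
    p.continuous_eval
  have hpos : ∀ᶠ t : ℝ in 𝓝[>] 0, 0 < t := self_mem_nhdsWithin
  refine ⟨?_, fun N p hp => ?_⟩
  · by_contra ha
    have hpos' : 0 < ‖eval a F‖ / 2 := by positivity
    have hU : ∀ᶠ y in 𝓝 a, ‖eval a F‖ / 2 < ‖eval y F‖ :=
      (hcont F).norm.continuousAt.eventually_const_lt (half_lt_self (norm_pos_iff.2 ha))
    have hsmall : ∀ᶠ t : ℝ in 𝓝[>] 0, ‖(t : ℂ) * ξ‖ < ‖eval a F‖ / 2 := by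
      have : Continuous fun t : ℝ => ‖(t : ℂ) * ξ‖ := by fun_prop
      exact (this.continuousAt.eventually_lt_const (by simpa using ha)).filter_mono
        nhdsWithin_le_nhds
    obtain ⟨t, ⟨y, hyU, hyF, -⟩, ht⟩ := ((h _ hU).and_eventually hsmall).exists
    have hyU' : ‖eval a F‖ / 2 < ‖eval y F‖ := hyU
    rw [hyF] at hyU'
    exact lt_asymm hyU' ht
  · by_contra ha
    have hU : ∀ᶠ y in 𝓝 a, eval y p ≠ 0 := (hcont p).continuousAt.eventually_ne ha
    obtain ⟨t, ⟨y, hyU, hyF, hyG⟩, ht⟩ := ((h _ hU).and_eventually hpos).exists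
    refine hyU (eval₂_eq_zero_of_mem_span (ι := RingHom.id ℂ) (F := F) (N := N) ?_ hyG hp)
    change eval y F ≠ 0
    rw [hyF]
    exact mul_ne_zero (by exact_mod_cast ht.ne') hξ

/-- A limit point is approached by the fibres over `tξ` for all small `t`. Otherwise some
ultrafilter would avoid a neighbourhood of the point, although the field of germs along that
ultrafilter contains a point of the fibre over the germ `tξ` infinitely close to it. -/
theorem IsLimitPoint.eventually_exists {F : MvPolynomial (Fin n) ℂ}
    {G : Fin m → MvPolynomial (Fin n) ℂ} {a : Fin n → ℂ} (ha : IsLimitPoint F G a) {ξ : ℂ}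
    (hξ : ξ ≠ 0) {U : Set (Fin n → ℂ)} (hU : U ∈ 𝓝 a) : ∀ᶠ t : ℝ in 𝓝[>] 0,
      ∃ y ∈ U, eval y F = t * ξ ∧ ∀ j, eval y (G j) = 0 := by
  by_contra hcon
  rw [not_eventually, frequently_iff_neBot] at hcon
  let 𝒰 : Ultrafilter ℝ := Ultrafilter.of (𝓝[>] 0 ⊓ 𝓟 {t : ℝ | ¬∃ y ∈ U, eval y F = t * ξ ∧
    ∀ j, eval y (G j) = 0})
  have hle : (𝒰 : Filter ℝ) ≤ 𝓝[>] 0 ⊓ 𝓟 {t : ℝ | ¬∃ y ∈ U, eval y F = t * ξ ∧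
      ∀ j, eval y (G j) = 0} := Ultrafilter.of_le _
  have hle0 : (𝒰 : Filter ℝ) ≤ 𝓝[>] 0 := hle.trans inf_le_left
  have hnot : ∀ᶠ t : ℝ in 𝒰, ¬∃ y ∈ U, eval y F = t * ξ ∧ ∀ j, eval y (G j) = 0 :=
    hle (mem_inf_of_right (mem_principal_self _))
  have : IsAlgClosed (Germ (𝒰 : Filter ℝ) ℂ) := Germ.isAlgClosed_ultrafilter 𝒰
  let ι : ℂ →+* Germ (𝒰 : Filter ℝ) ℂ := (Germ.coeRingHom _).comp (Pi.constRingHom ℝ ℂ)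
  let τ : ℝ → ℂ := fun t => t * ξ
  have hτ : (↑τ : Germ (𝒰 : Filter ℝ) ℂ) ∈ (Germ.boundedSubring 𝒰).nonunits := by
    rw [Germ.coe_mem_nonunits_boundedSubring]
    intro δ hδ
    have : Continuous fun t : ℝ => ‖(t : ℂ) * ξ‖ := by fun_prop
    exact hle0 ((this.continuousAt.eventually_lt_const (by simpa using hδ)).filter_mono
      nhdsWithin_le_nhds)
  have hpos : ∀ᶠ t : ℝ in 𝒰, 0 < t := hle0 self_mem_nhdsWithin
  have hτ0 : (↑τ : Germ (𝒰 : Filter ℝ) ℂ) ≠ 0 := fun h => by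
    have h' : τ =ᶠ[𝒰] 0 := Germ.coe_eq.1 h
    obtain ⟨t, h1, h2⟩ := (h'.and hpos).exists
    exact mul_ne_zero (by exact_mod_cast h2.ne') hξ h1
  obtain ⟨x, hxF, hxG, hxa⟩ := ha.exists_specializing (Germ.boundedSubring 𝒰) ι
    (Germ.const_mem_boundedSubring 𝒰) hτ hτ0
  have hrep : ∀ i, ∃ u : ℝ → ℂ, Germ.coeRingHom (𝒰 : Filter ℝ) u = x i := fun i =>
    Germ.inductionOn (x i) fun u => ⟨u, rfl⟩
  choose u hu using hrep
  have heval : ∀ p : MvPolynomial (Fin n) ℂ, eval₂ ι x p =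
      (↑(fun t => eval (fun i => u i t) p) : Germ (𝒰 : Filter ℝ) ℂ) := by
    intro p
    have h1 : x = Germ.coeRingHom (𝒰 : Filter ℝ) ∘ u := funext fun i => (hu i).symm
    rw [h1, ← eval₂_comp_left]
    change Germ.coeRingHom (𝒰 : Filter ℝ) _ = Germ.coeRingHom (𝒰 : Filter ℝ) _
    congr 1
    funext t
    exact eval₂_comp_left (Pi.evalRingHom (fun _ : ℝ => ℂ) t) (Pi.constRingHom ℝ ℂ) u p
  have hF : ∀ᶠ t : ℝ in 𝒰, eval (fun i => u i t) F = t * ξ :=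
    Germ.coe_eq.1 ((heval F).symm.trans hxF)
  have hG : ∀ᶠ t : ℝ in 𝒰, ∀ j, eval (fun i => u i t) (G j) = 0 :=
    eventually_all.2 fun j => Germ.coe_eq.1 ((heval (G j)).symm.trans (hxG j))
  obtain ⟨δ, hδ, hball⟩ := Metric.mem_nhds_iff.1 hU
  have hclose : ∀ᶠ t : ℝ in 𝒰, ∀ i, ‖u i t - a i‖ < δ := by
    refine eventually_all.2 fun i => ?_
    have := hxa i
    rw [← hu i] at this
    exact Germ.coe_mem_nonunits_boundedSubring.1 this δ hδ
  obtain ⟨t, h1, h2, h3, h4⟩ := (hnot.and (hF.and (hG.and hclose))).exists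
  refine h1 ⟨fun i => u i t, hball ?_, h2, h3⟩
  rw [Metric.mem_ball, dist_pi_lt_iff hδ]
  exact fun i => by rw [dist_eq_norm]; exact h4 i

end RealFibers

theorem mainTheorem6 (n m : ℕ) (f : MvPolynomial (Fin n) ℝ)
    (g : Fin m → MvPolynomial (Fin n) ℝ)
    (hsmooth : IsSmoothAlgebraicSet
      (fiberSet ((Puiseux.const ℂ).comp Complex.ofRealHom) f g (Puiseux.eps ℂ)))
    (hdim : IsEquidimensional
      (fiberSet ((Puiseux.const ℂ).comp Complex.ofRealHom) f g (Puiseux.eps ℂ))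
      ((n : ℤ) - (m : ℤ) - 1))
    (ξ : ℂ) (hξ : ‖ξ‖ = 1)
    (hsmoothξ : ∀ t : ℝ, t ∈ Set.Ioc (0 : ℝ) 1 →
      IsSmoothAlgebraicSet (fiberSet Complex.ofRealHom f g ((t : ℂ) * ξ)))
    (hdimξ : ∀ t : ℝ, t ∈ Set.Ioc (0 : ℝ) 1 →
      IsEquidimensional (fiberSet Complex.ofRealHom f g ((t : ℂ) * ξ))
        ((n : ℤ) - (m : ℤ) - 1)) :
    HasSetLimit (fun t : ℝ => fiberSet Complex.ofRealHom f g ((t : ℂ) * ξ))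
      (nhdsWithin 0 (Set.Ioi 0))
      (Puiseux.limitSet
        (fiberSet ((Puiseux.const ℂ).comp Complex.ofRealHom) f g (Puiseux.eps ℂ))) := by
  have hξ0 : ξ ≠ 0 := fun h => by simp [h] at hξ
  have hiff : ∀ (t : ℝ) (U : Set (Fin n → ℂ)),
      (fiberSet Complex.ofRealHom f g ((t : ℂ) * ξ) ∩ U).Nonempty ↔
        ∃ y ∈ U, MvPolynomial.eval y (MvPolynomial.map Complex.ofRealHom f) = t * ξ ∧
          ∀ j, MvPolynomial.eval y (MvPolynomial.map Complex.ofRealHom (g j)) = 0 := fun t U => by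
    simp only [Set.Nonempty, Set.mem_inter_iff, mem_fiberSet_ofRealHom_iff, and_comm]
  refine ⟨fun a ha U hU => ?_, fun a ha => ?_⟩
  · simp only [hiff]
    exact ((mem_limitSet_fiberSet_iff f g a).1 ha).eventually_exists hξ0 hU
  · simp only [hiff] at ha
    exact (mem_limitSet_fiberSet_iff f g a).2 (isLimitPoint_of_frequently hξ0 ha)
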